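/- **Setting.** Let $(M,d)$ be a metric space whose topology is Polish, with Borel $\sigma$-algebra $\mathcal B$, let $\kappa\colon M\to(0,\infty)$ be continuous and bounded, and let $\Lambda\neq\emptyset$ be an index set. Let $C_b(M)$ be the space of bounded continuous functions $M\to\mathbb R$, $\mathrm{Lip}_b$ the space of bounded Lipschitz functions $M\to\mathbb R$, and $\|u\|_{\mathrm{Lip}}$ the smallest Lipschitz constant of $u$ ($\infty$ if there is none). Let $\|u\|_\kappa=\sup_{x}|\kappa(x)u(x)|$, and let $\mathrm{UC}_\kappa$ be the $\|\cdot\|_\kappa$-closure of $\mathrm{Lip}_b$ in the space of continuous $u\colon M\to\mathbb R$ with $\|u\|_\kappa<\infty$. For functions on $M$, $u_n\nearrow u$ (resp. $u_n\searrow u$) means that $(u_n)_n$ is pointwise increasing (resp. decreasing) and converges pointwise to $u$. A *Feller semigroup* is a family of $\|\cdot\|_\kappa$-continuous operators $S(t)\colon\mathrm{UC}_\kappa\to\mathrm{UC}_\kappa$, $t\ge0$, with $S(0)u=u$, $S(s+t)u=S(s)S(t)u$, each $S(t)$ being monotone and continuous from below ($u_n\nearrow u$ in $\mathrm{UC}_\kappa$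 implies $S(t)u_n\nearrow S(t)u$). For every $\lambda\in\Lambda$ let $S_\lambda$ be a Feller semigroup of linear operators with $S_\lambda(t)1=1$, and suppose there are $\alpha,\beta\in\mathbb R$ with $$\|S_\lambda(t)u\|_\kappa\le e^{\alpha t}\|u\|_\kappa,\qquad \|S_\lambda(t)u\|_{\mathrm{Lip}}\le e^{\beta t}\|u\|_{\mathrm{Lip}}\qquad\text{for all }u\in\mathrm{Lip}_b,\ \lambda\in\Lambda,\ t\ge0.$$ Put $(\mathcal E_hu)(x)=\sup_{\lambda}(S_\lambda(h)u)(x)$ for $h\ge0$, $u\in\mathrm{UC}_\kappa$. For a finite set $\pi=\{t_0<t_1<\dots<t_m\}\subset[0,\infty)$ with $t_0=0$ put $\mathcal E_\pi u=\mathcal E_{t_1-t_0}\cdots\mathcal E_{t_m-t_{m-1}}u$ (and $\mathcal E_{\{0\}}u=u$). The *semigroup envelope* is $$(\mathscr S(t)u)(x)=\sup\{(\mathcal E_\pi u)(x)\,:\,\pi\subset[0,\infty)\text{ finite},\ 0\in\pi,\ \max\pi=t\},\qquad u\in\mathrm{UC}_\kappa,\ t\ge0,\ x\in M.$$ For a measurable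 space $(\Omega,\mathcal F)$ let $\mathcal L^\infty(\Omega,\mathcal F)$ be the space of bounded measurable functions $\Omega\to\mathbb R$. A functional $\mathcal E\colon\mathcal L^\infty(\Omega,\mathcal F)\to\mathbb R$ is a *sublinear expectation* if it is monotone, $\mathcal E(a)=a$ for constants $a\in\mathbb R$, $\mathcal E(X+Y)\le\mathcal E(X)+\mathcal E(Y)$, and $\mathcal E(rX)=r\mathcal E(X)$ for $r>0$; $(\Omega,\mathcal F,\mathcal E)$ is a *sublinear expectation space* if moreover $\mathcal E(X)=\sup_{P\in\mathcal P}\mathbb E_P(X)$ for all $X\in\mathcal L^\infty(\Omega,\mathcal F)$, for some nonempty set $\mathcal P$ of probability measures on $(\Omega,\mathcal F)$. **Theorem.** Suppose that $\mathscr S$ is continuous from above on $\mathrm{Lip}_b$, i.e. $\mathscr S(t)u_n\searrow0$ for all $t\ge0$ and all $(u_n)_n\subset\mathrm{Lip}_b$ with $u_n\searrow0$. Then for every $t\ge 0$ the restriction of $\mathscr S(t)$ to $\mathrm{Lip}_b$ extends uniquely to an operator $C_b(M)\to C_b(M)$ that is continuous from above ($u_n\searrow u$ in $C_b(M)$ implies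 $\mathscr S(t)u_n\searrow\mathscr S(t)u$). The extension, again denoted $\mathscr S(t)$, agrees with the envelope on $\mathrm{UC}_\kappa\cap C_b(M)$. Moreover, there exists a quadruple $(\Omega,\mathcal F,(\mathcal E^x)_{x\in M},(X_t)_{t\ge0})$ such that (i) $X_t\colon\Omega\to M$ is $\mathcal F$-$\mathcal B$-measurable for all $t\ge0$; (ii) $(\Omega,\mathcal F,\mathcal E^x)$ is a sublinear expectation space with $\mathcal E^x(u(X_0))=u(x)$ for all $x\in M$ and $u\in C_b(M)$; (iii) for all $x\in M$, $0\le s<t$, $n\in\mathbb N_0$, $0\le t_1<\dots<t_n\le s$ and $v\in C_b(M^{n+1})$, the function $\big(\mathscr S(t-s)v(X_{t_1},\dots,X_{t_n},\,\cdot\,)\big)(X_s)$ belongs to $\mathcal L^\infty(\Omega,\mathcal F)$ and $$\mathcal E^x\big(v(X_{t_1},\dots,X_{t_n},X_t)\big)=\mathcal E^x\Big(\big(\mathscr S(t-s)v(X_{t_1},\dots,X_{t_n},\,\cdot\,)\big)(X_s)\Big).$$ In particular, $(\mathscr S(t)u)(x)=\mathcal E^x(u(X_t))$ for all $t\ge0$,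 $x\in M$ and $u\in C_b(M)$. -/

import Mathlib

open scoped BoundedContinuousFunction NNReal ENNReal Topology

universe u w

noncomputable section

namespace SemigroupEnvelope

open Filter MeasureTheory

/-! ### Function spaces -/

/-- A weight function `κ : M → (0, ∞)`: continuous and bounded. -/
structure Weight (M : Type*) [TopologicalSpace M] where
  toFun : M → ℝ
  continuous_toFun : Continuous toFun
  pos : ∀ x, 0 < toFun x
  bounded : ∃ C : ℝ, ∀ x, toFun x ≤ C

/-- The weighted norm `‖u‖_κ = sup_x |κ(x) u(x)|`, with value `∞` if the supremum is infinite. -/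
def wNorm {M : Type*} [TopologicalSpace M] (κ : Weight M) (u : M → ℝ) : ℝ≥0∞ :=
  ⨆ x, ‖κ.toFun x * u x‖ₑ

/-- The Lipschitz seminorm: the infimum of all Lipschitz constants of `u`, `∞` if there is none. -/
def lipNorm {M : Type*} [MetricSpace M] (u : M → ℝ) : ℝ≥0∞ :=
  ⨅ (L : ℝ≥0) (_ : LipschitzWith L u), (L : ℝ≥0∞)

/-- `Lip_b`: the bounded Lipschitz functions. -/
def LipB (M : Type*) [MetricSpace M] : Submodule ℝ (M → ℝ) where
  carrier := {u | (∃ L : ℝ≥0, LipschitzWith L u) ∧ ∃ C : ℝ, ∀ x, |u x| ≤ C}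
  zero_mem' := ⟨⟨0, LipschitzWith.const 0⟩, 0, fun x => by simp⟩
  add_mem' := by
    rintro u v ⟨⟨L, hL⟩, C, hC⟩ ⟨⟨K, hK⟩, D, hD⟩
    exact ⟨⟨L + K, hL.add hK⟩, C + D, fun x => (abs_add_le _ _).trans (add_le_add (hC x) (hD x))⟩
  smul_mem' := by
    rintro c u ⟨⟨L, hL⟩, C, hC⟩
    refine ⟨⟨‖c‖₊ * L, (lipschitzWith_smul c).comp hL⟩, |c| * C, fun x => ?_⟩
    simp only [Pi.smul_apply, smul_eq_mul, abs_mul]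
    exact mul_le_mul_of_nonneg_left (hC x) (abs_nonneg c)

theorem wNorm_add_le {M : Type*} [TopologicalSpace M] (κ : Weight M) (u v : M → ℝ) :
    wNorm κ (u + v) ≤ wNorm κ u + wNorm κ v := by
  refine iSup_le fun x => ?_
  rw [Pi.add_apply, mul_add]
  exact (enorm_add_le _ _).trans
    (add_le_add (le_iSup (fun x => ‖κ.toFun x * u x‖ₑ) x) (le_iSup (fun x => ‖κ.toFun x * v x‖ₑ) x))

theorem wNorm_smul {M : Type*} [TopologicalSpace M] (κ : Weight M) (c : ℝ) (u : M → ℝ) :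
    wNorm κ (c • u) = ‖c‖ₑ * wNorm κ u := by
  unfold wNorm
  rw [ENNReal.mul_iSup]
  refine iSup_congr fun x => ?_
  rw [Pi.smul_apply, smul_eq_mul, mul_left_comm, enorm_mul]

/-- `UC_κ`: the closure of `Lip_b` with respect to `‖·‖_κ` in the space `C_κ` of all continuous
functions `u` with `‖u‖_κ < ∞`. -/
def UC {M : Type*} [MetricSpace M] (κ : Weight M) : Submodule ℝ (M → ℝ) where
  carrier := {u | (Continuous u ∧ wNorm κ u < ∞) ∧
    ∀ ε : ℝ≥0∞, 0 < ε → ∃ v ∈ LipB M, wNorm κ (u - v) < ε}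
  zero_mem' := by
    refine ⟨⟨continuous_zero, by simp [wNorm]⟩, fun ε hε => ⟨0, zero_mem _, by simpa [wNorm] using hε⟩⟩
  add_mem' := by
    rintro u v ⟨⟨hu, hu'⟩, hu''⟩ ⟨⟨hv, hv'⟩, hv''⟩
    refine ⟨⟨hu.add hv, (wNorm_add_le κ u v).trans_lt (ENNReal.add_lt_top.2 ⟨hu', hv'⟩)⟩,
      fun ε hε => ?_⟩
    obtain ⟨a, ha, ha'⟩ := hu'' (ε / 2) (ENNReal.half_pos hε.ne')
    obtain ⟨b, hb, hb'⟩ := hv'' (ε / 2) (ENNReal.half_pos hε.ne')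
    refine ⟨a + b, add_mem ha hb, ?_⟩
    rw [add_sub_add_comm]
    exact (wNorm_add_le κ _ _).trans_lt
      ((ENNReal.add_lt_add ha' hb').trans_eq (ENNReal.add_halves ε))
  smul_mem' := by
    rintro c u ⟨⟨hu, hu'⟩, hu''⟩
    refine ⟨⟨hu.const_smul c, ?_⟩, fun ε hε => ?_⟩
    · rw [wNorm_smul]
      exact ENNReal.mul_lt_top enorm_lt_top hu'
    · rcases eq_or_ne c 0 with rfl | hc
      · exact ⟨0, zero_mem _, by simpa [wNorm] using hε⟩
      · have hc0 : ‖c‖ₑ ≠ 0 := by simpa using hc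
        obtain ⟨a, ha, ha'⟩ := hu'' (ε / ‖c‖ₑ) (ENNReal.div_pos hε.ne' enorm_ne_top)
        refine ⟨c • a, Submodule.smul_mem _ c ha, ?_⟩
        rw [← smul_sub, wNorm_smul, mul_comm]
        exact (ENNReal.lt_div_iff_mul_lt (Or.inl hc0) (Or.inl enorm_ne_top)).1 ha'

theorem one_mem_UC {M : Type*} [MetricSpace M] (κ : Weight M) : (fun _ => 1 : M → ℝ) ∈ UC κ := by
  refine ⟨⟨continuous_const, ?_⟩, fun ε hε => ⟨fun _ => 1, ⟨⟨0, LipschitzWith.const 1⟩, 1, by simp⟩, ?_⟩⟩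
  · obtain ⟨C, hC⟩ := κ.bounded
    refine lt_of_le_of_lt (iSup_le fun x => ?_) (ENNReal.ofReal_lt_top (r := C))
    rw [mul_one, Real.enorm_eq_ofReal (κ.pos x).le]
    exact ENNReal.ofReal_le_ofReal (hC x)
  · simpa [wNorm] using hε

/-- The constant function `1` as an element of `UC_κ`. -/
def oneUC {M : Type*} [MetricSpace M] (κ : Weight M) : UC κ := ⟨fun _ => 1, one_mem_UC κ⟩

/-- `u_n ↗ w`: the sequence increases and converges pointwise to `w`. -/
def IncreasesTo {M : Type*} (u : ℕ → M → ℝ) (w : M → ℝ) : Prop :=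
  (∀ n x, u n x ≤ u (n + 1) x) ∧ ∀ x, Tendsto (fun n => u n x) atTop (𝓝 (w x))

/-- `u_n ↘ w`: the sequence decreases and converges pointwise to `w`. -/
def DecreasesTo {M : Type*} (u : ℕ → M → ℝ) (w : M → ℝ) : Prop :=
  (∀ n x, u (n + 1) x ≤ u n x) ∧ ∀ x, Tendsto (fun n => u n x) atTop (𝓝 (w x))

/-! ### Feller semigroups and the semigroup envelope -/

/-- Feller semigroups of (possibly nonlinear) operators on `UC_κ`. -/
structure IsFellerSemigroup {M : Type*} [MetricSpace M] (κ : Weight M)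
    (S : ℝ≥0 → UC κ → UC κ) : Prop where
  /-- every `S t` is continuous with respect to `‖·‖_κ` -/
  continuous : ∀ (t : ℝ≥0) (u : UC κ) (ε : ℝ≥0∞), 0 < ε → ∃ δ : ℝ≥0∞, 0 < δ ∧
    ∀ v : UC κ, wNorm κ ((v : M → ℝ) - (u : M → ℝ)) < δ →
      wNorm κ ((S t v : M → ℝ) - (S t u : M → ℝ)) < ε
  zero : ∀ u, S 0 u = u
  add : ∀ (s t : ℝ≥0) (u : UC κ), S (s + t) u = S s (S t u)
  monotone : ∀ (t : ℝ≥0) (u v : UC κ), (∀ x, (u : M → ℝ) x ≤ (v : M → ℝ) x) →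
    ∀ x, (S t u : M → ℝ) x ≤ (S t v : M → ℝ) x
  continuous_from_below : ∀ (t : ℝ≥0) (u : ℕ → UC κ) (w : UC κ),
    IncreasesTo (fun n => (u n : M → ℝ)) (w : M → ℝ) →
      IncreasesTo (fun n => (S t (u n) : M → ℝ)) (S t w : M → ℝ)

/-- Every member of the family is a Feller semigroup of linear operators that fix the constant `1`. -/
def IsLinearFellerFamily {M Λ : Type*} [MetricSpace M] (κ : Weight M)
    (S : Λ → ℝ≥0 → UC κ →ₗ[ℝ] UC κ) : Prop :=
  ∀ l : Λ, IsFellerSemigroup κ (fun t u => S l t u) ∧ ∀ t : ℝ≥0, S l t (oneUC κ) = oneUC κ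

/-- Uniform exponential bounds in `‖·‖_κ` and in the Lipschitz seminorm on `Lip_b`. -/
def HasUniformBounds {M Λ : Type*} [MetricSpace M] (κ : Weight M)
    (S : Λ → ℝ≥0 → UC κ →ₗ[ℝ] UC κ) : Prop :=
  ∃ α β : ℝ, ∀ (u : UC κ), (u : M → ℝ) ∈ LipB M → ∀ (l : Λ) (t : ℝ≥0),
    wNorm κ (S l t u : M → ℝ) ≤ ENNReal.ofReal (Real.exp (α * t)) * wNorm κ (u : M → ℝ) ∧
    lipNorm (S l t u : M → ℝ) ≤ ENNReal.ofReal (Real.exp (β * t)) * lipNorm (u : M → ℝ)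

open Classical in
/-- `(𝓔_h u)(x) = sup_λ (S_λ(h) u)(x)` for `u ∈ UC_κ`. Under `IsLinearFellerFamily` and
`HasUniformBounds` the supremum is finite and `𝓔_h` maps `UC_κ` into itself, so the
value given to functions outside of `UC_κ` plays no role when these operators are composed. -/
def supOp {M Λ : Type*} [MetricSpace M] {κ : Weight M}
    (S : Λ → ℝ≥0 → UC κ →ₗ[ℝ] UC κ) (h : ℝ≥0) (u : M → ℝ) : M → ℝ := fun x =>
  if hu : u ∈ UC κ then ⨆ l : Λ, (S l h ⟨u, hu⟩ : M → ℝ) x else 0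

/-- `𝓔_{t₁ - t₀} ⋯ 𝓔_{t_m - t_{m-1}} u` for the list `[t₀, …, t_m]`; the identity for one point. -/
def listOp {M Λ : Type*} [MetricSpace M] {κ : Weight M}
    (S : Λ → ℝ≥0 → UC κ →ₗ[ℝ] UC κ) : List ℝ≥0 → (M → ℝ) → M → ℝ
  | a :: b :: l, u => supOp S (b - a) (listOp S (b :: l) u)
  | _, u => u

/-- `𝓔_π u` for a finite set `π ⊆ [0, ∞)`, listed in increasing order. -/
def partOp {M Λ : Type*} [MetricSpace M] {κ : Weight M}
    (S : Λ → ℝ≥0 → UC κ →ₗ[ℝ] UC κ) (π : Finset ℝ≥0) (u : M → ℝ) : M → ℝ :=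
  listOp S (π.sort (· ≤ ·)) u

/-- `P_t`: the finite partitions with `0 ∈ π` and `max π = t`. -/
def Partitions (t : ℝ≥0) : Set (Finset ℝ≥0) :=
  {π | 0 ∈ π ∧ IsGreatest (π : Set ℝ≥0) t}

/-- The semigroup envelope (Nisio semigroup): `(𝒮(t)u)(x) = sup_{π ∈ P_t} (𝓔_π u)(x)`,
for `u ∈ UC_κ`. -/
def envelope {M Λ : Type*} [MetricSpace M] {κ : Weight M}
    (S : Λ → ℝ≥0 → UC κ →ₗ[ℝ] UC κ) (t : ℝ≥0) (u : M → ℝ) : M → ℝ := fun x =>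
  ⨆ π : Partitions t, partOp S (π : Finset ℝ≥0) u x

/-- A family of operators is continuous from above on a linear space `L`: `𝒮(t) u_n ↘ 0` for all
`t ≥ 0` and all sequences in `L` with `u_n ↘ 0`. -/
def ContinuousFromAboveOn {M : Type*} (T : ℝ≥0 → (M → ℝ) → M → ℝ)
    (L : Submodule ℝ (M → ℝ)) : Prop :=
  ∀ (t : ℝ≥0) (u : ℕ → M → ℝ), (∀ n, u n ∈ L) → DecreasesTo u 0 →
    DecreasesTo (fun n => T t (u n)) 0

/-- `T` is an extension of the envelope from `Lip_b` to operators `C_b → C_b` that are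
continuous from above. -/
structure IsExtension {M Λ : Type*} [MetricSpace M] {κ : Weight M}
    (S : Λ → ℝ≥0 → UC κ →ₗ[ℝ] UC κ) (T : ℝ≥0 → (M →ᵇ ℝ) → (M →ᵇ ℝ)) : Prop where
  extends_envelope : ∀ (t : ℝ≥0) (u : M →ᵇ ℝ), (u : M → ℝ) ∈ LipB M →
    (T t u : M → ℝ) = envelope S t u
  continuous_from_above : ∀ (t : ℝ≥0) (u : ℕ → M →ᵇ ℝ) (w : M →ᵇ ℝ),
    DecreasesTo (fun n => (u n : M → ℝ)) w → DecreasesTo (fun n => (T t (u n) : M → ℝ)) (T t w)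

/-! ### Sublinear expectations -/

/-- `𝓛^∞(Ω, 𝓕)`: the bounded measurable functions `Ω → ℝ`. -/
def LInfty (Ω : Type*) [MeasurableSpace Ω] : Submodule ℝ (Ω → ℝ) where
  carrier := {f | Measurable f ∧ ∃ C : ℝ, ∀ ω, |f ω| ≤ C}
  zero_mem' := ⟨measurable_zero, 0, fun x => by simp⟩
  add_mem' := by
    rintro u v ⟨hu, C, hC⟩ ⟨hv, D, hD⟩
    exact ⟨hu.add hv, C + D, fun x => (abs_add_le _ _).trans (add_le_add (hC x) (hD x))⟩
  smul_mem' := by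
    rintro c u ⟨hu, C, hC⟩
    refine ⟨hu.const_smul c, |c| * C, fun x => ?_⟩
    simp only [Pi.smul_apply, smul_eq_mul, abs_mul]
    exact mul_le_mul_of_nonneg_left (hC x) (abs_nonneg c)

/-- Sublinear expectations on `𝓛^∞(Ω, 𝓕)`. -/
structure IsSublinearExpectation {Ω : Type*} [MeasurableSpace Ω] (E : LInfty Ω → ℝ) : Prop where
  monotone : ∀ X Y : LInfty Ω, (∀ ω, (X : Ω → ℝ) ω ≤ (Y : Ω → ℝ) ω) → E X ≤ E Y
  const : ∀ (a : ℝ) (X : LInfty Ω), (∀ ω, (X : Ω → ℝ) ω = a) → E X = a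
  add_le : ∀ X Y : LInfty Ω, E (X + Y) ≤ E X + E Y
  smul : ∀ (r : ℝ), 0 < r → ∀ X : LInfty Ω, E (r • X) = r * E X

/-- `(Ω, 𝓕, E)` is a sublinear expectation space: `E` is a sublinear expectation and
`E(X) = sup_{P ∈ Q} E_P(X)` for a (nonempty) set `Q` of probability measures. -/
def IsSublinearExpectationSpace {Ω : Type*} [MeasurableSpace Ω] (E : LInfty Ω → ℝ) : Prop :=
  IsSublinearExpectation E ∧ ∃ Q : Set (ProbabilityMeasure Ω), Q.Nonempty ∧
    ∀ X : LInfty Ω,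
      IsLUB ((fun P : ProbabilityMeasure Ω => ∫ ω, (X : Ω → ℝ) ω ∂(P : Measure Ω)) '' Q) (E X)

/-- The function `v(x₁, …, x_n, ·) ∈ C_b(M)` for `v ∈ C_b(M^{n+1})`. -/
def sectionLast {M : Type*} [TopologicalSpace M] {n : ℕ} (v : (Fin (n + 1) → M) →ᵇ ℝ)
    (x : Fin n → M) : M →ᵇ ℝ :=
  v.compContinuous ⟨fun y => (Fin.snoc x y : Fin (n + 1) → M),
    Continuous.finSnoc continuous_const continuous_id⟩

end SemigroupEnvelope

end

noncomputable section

namespace SemigroupEnvelope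

open Filter MeasureTheory

/-! ### Regularization by sup-convolution -/

/-! The proof has two halves, an extension problem and a representation problem.

Extension. The `S_λ` are positive, linear and fix `1`, so compositions of the `𝓔_h` are monotone,
sublinear and preserve constants. The exponential bounds multiply along a partition to a bound
depending only on its total length, so on `Lip_b` all compositions of length `t` share one Lipschitz
constant. Refining a partition increases its value, because keeping one `λ` over a long interval is
a special case of choosing it on each piece. Directedness, equi-Lipschitz continuity and
separability make the envelope of `u ∈ Lip_b` the limit of an increasing sequence of compositions.
Continuity from below then yields the semigroup property (`envelope_add_time`). A bounded continuous
`u` lies between `a_n ↗ u` and `b_n ↘ u` in `Lip_b`. Sublinearity gives `𝒮(t)b_n - 𝒮(t)a_n ≤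
𝒮(t)(b_n - a_n)`, which tends to `0` by continuity from above. The two limits therefore coincide
(`tendsto_envelope_sandwich`). This defines the extension, makes it continuous and forces its
uniqueness; a diagonal sequence gives continuity from above.

Representation. On `Ω = M^[0,∞)` the coordinates are integrated out one at a time with the extended
semigroup. This stays inside bounded continuous cylinder functions by
`IsSublinearSemigroup.continuous_joint`, and the semigroup law makes the finite-dimensional
expectations consistent (`finExp_eq_of_subset`). For each cylinder function, Hahn–Banach gives a
linear functional that is dominated by the path expectation and touches it there; domination passes
on positivity, normalization and continuity from above on finitely many coordinates. Such a
functional comes from a probability measure: embed `M` in a compact metric space `K`, apply Riesz on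
`K^[0,∞)`, show that each single coordinate lies in the image of `M` almost surely, and pull back
coordinatewise by a measurable left inverse (`exists_probabilityMeasure_of_isPathFunctional`). `𝓔^x`
is the supremum over all dominated measures, and it agrees with the path expectation on cylinder
functions. -/

/-- The sup-convolution of `v : A → ℝ` along `ι : A → B`. -/
def supConv {A B : Type*} [PseudoMetricSpace B] (ι : A → B) (v : A → ℝ) (n : ℕ) (b : B) : ℝ :=
  ⨆ a, (v a - n * dist b (ι a))

section SupConv

variable {A B : Type*} [PseudoMetricSpace B] {ι : A → B} {v w : A → ℝ} {C : ℝ}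

theorem bddAbove_supConv (hC : ∀ a, |v a| ≤ C) (n : ℕ) (b : B) :
    BddAbove (Set.range fun a => v a - n * dist b (ι a)) := by
  refine ⟨C, ?_⟩
  rintro _ ⟨a, rfl⟩
  have : 0 ≤ (n : ℝ) * dist b (ι a) := by positivity
  linarith [(abs_le.1 (hC a)).2]

theorem le_supConv (hC : ∀ a, |v a| ≤ C) (n : ℕ) (a : A) : v a ≤ supConv ι v n (ι a) := by
  have := le_ciSup (bddAbove_supConv (ι := ι) hC n (ι a)) a
  simpa [supConv] using this

theorem supConv_le [Nonempty A] (hC : ∀ a, |v a| ≤ C) (n : ℕ) (b : B) : supConv ι v n b ≤ C := by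
  refine ciSup_le fun a => ?_
  have : 0 ≤ (n : ℝ) * dist b (ι a) := by positivity
  linarith [(abs_le.1 (hC a)).2]

/-- Monotonicity in the index and the function at once is what makes the diagonal sequence `supConv
id (u n) n` decrease. -/
theorem supConv_mono [Nonempty A] (hC : ∀ a, |w a| ≤ C) (hvw : ∀ a, v a ≤ w a) {m n : ℕ}
    (hmn : m ≤ n) (b : B) : supConv ι v n b ≤ supConv ι w m b := by
  refine ciSup_mono (bddAbove_supConv hC m b) fun a => ?_
  have : (m : ℝ) * dist b (ι a) ≤ n * dist b (ι a) := by gcongr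
  linarith [hvw a]

theorem lipschitzWith_supConv [Nonempty A] (hC : ∀ a, |v a| ≤ C) (n : ℕ) :
    LipschitzWith n (supConv ι v n) := by
  refine LipschitzWith.of_le_add_mul _ fun x y => ciSup_le fun a => ?_
  have h := le_ciSup (bddAbove_supConv (ι := ι) hC n y) a
  have h' : (n : ℝ) * dist y (ι a) ≤ n * (dist x y + dist x (ι a)) := by
    gcongr
    linarith [dist_triangle y x (ι a), dist_comm x y]
  simp only [NNReal.coe_natCast]
  change _ ≤ supConv ι v n y + _
  change _ ≤ supConv ι v n y at h
  nlinarith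

/-- Points within `δ` of `ι a` have values below `v a + ε / 2`, and farther points pay a penalty of
at least `2 * C`. The inducing map `ι` is kept general because the result serves both for the
identity of `M` and for finite powers of an embedding of `M` into a compact space. -/
theorem tendsto_supConv [TopologicalSpace A] (hι : Topology.IsInducing ι) (hv : Continuous v)
    (hC : ∀ a, |v a| ≤ C) (a : A) :
    Tendsto (fun n => supConv ι v n (ι a)) atTop (𝓝 (v a)) := by
  have : Nonempty A := ⟨a⟩
  rw [Metric.tendsto_atTop]
  intro ε hε
  have hmem : {a' | v a' < v a + ε / 2} ∈ 𝓝 a :=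
    hv.continuousAt.eventually_lt continuousAt_const (by linarith)
  rw [hι.nhds_eq_comap, mem_comap] at hmem
  obtain ⟨t, ht, hts⟩ := hmem
  obtain ⟨δ, hδ, hball⟩ := Metric.mem_nhds_iff.1 ht
  obtain ⟨N, hN⟩ := exists_nat_ge (2 * C / δ)
  refine ⟨N, fun n hn => ?_⟩
  have h1 := le_supConv (ι := ι) hC n a
  have h2 : supConv ι v n (ι a) ≤ v a + ε / 2 := by
    refine ciSup_le fun a' => ?_
    by_cases h : dist (ι a') (ι a) < δ
    · have : v a' < v a + ε / 2 := hts (hball h)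
      have : 0 ≤ (n : ℝ) * dist (ι a) (ι a') := by positivity
      linarith
    · push Not at h
      have h3 : 2 * C ≤ n * dist (ι a) (ι a') := by
        rw [div_le_iff₀ hδ] at hN
        have h4 : (N : ℝ) * δ ≤ n * dist (ι a) (ι a') := by
          rw [dist_comm]
          gcongr
        linarith
      linarith [(abs_le.1 (hC a')).2, (abs_le.1 (hC a)).1]
  rw [Real.dist_eq, abs_lt]
  constructor <;> linarith

end SupConv

/-- Bounded continuous real-valued functions, as a predicate. -/
def BC {X : Type*} [TopologicalSpace X] (u : X → ℝ) : Prop :=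
  Continuous u ∧ ∃ C : ℝ, ∀ x, |u x| ≤ C

section BC

variable {X Y : Type*} [TopologicalSpace X] [TopologicalSpace Y] {u v : X → ℝ}

theorem BC.add (hu : BC u) (hv : BC v) : BC (fun x => u x + v x) := by
  obtain ⟨hu, C, hC⟩ := hu
  obtain ⟨hv, D, hD⟩ := hv
  exact ⟨hu.add hv, C + D, fun x => (abs_add_le _ _).trans (add_le_add (hC x) (hD x))⟩

theorem BC.const_mul (hu : BC u) (r : ℝ) : BC (fun x => r * u x) := by
  obtain ⟨hu, C, hC⟩ := hu
  refine ⟨hu.const_mul r, |r| * C, fun x => ?_⟩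
  rw [abs_mul]
  exact mul_le_mul_of_nonneg_left (hC x) (abs_nonneg r)

theorem BC.const (c : ℝ) : BC (fun _ : X => c) := ⟨continuous_const, |c|, fun _ => le_rfl⟩

theorem BC.neg (hu : BC u) : BC (fun x => - u x) := by
  simpa using hu.const_mul (-1)

theorem BC.sub (hu : BC u) (hv : BC v) : BC (fun x => u x - v x) := by
  simpa [sub_eq_add_neg] using hu.add hv.neg

theorem BC.comp (hu : BC u) {f : Y → X} (hf : Continuous f) : BC (fun y => u (f y)) :=
  ⟨hu.1.comp hf, hu.2.imp fun _ h y => h (f y)⟩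

theorem BC.of_boundedContinuousFunction (u : X →ᵇ ℝ) : BC (u : X → ℝ) :=
  ⟨u.continuous, ‖u‖, fun x => u.norm_coe_le_norm x⟩

/-- The bundled version of a bounded continuous function. -/
def BC.toBCF (hu : BC u) : X →ᵇ ℝ :=
  BoundedContinuousFunction.ofNormedAddCommGroup u hu.1 hu.2.choose hu.2.choose_spec

theorem BC.of_lipB {M : Type*} [MetricSpace M] {u : M → ℝ} (hu : u ∈ LipB M) : BC u :=
  ⟨hu.1.choose_spec.continuous, hu.2⟩

end BC

/-! ### Monotone approximation of bounded continuous functions by `Lip_b` -/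

section LipB

variable {M : Type*} [MetricSpace M] {u : M → ℝ}

theorem LipB.const_mem (c : ℝ) : (fun _ => c) ∈ LipB M :=
  ⟨⟨0, LipschitzWith.const c⟩, |c|, fun _ => le_rfl⟩

theorem supConv_mem_lipB (hu : BC u) (n : ℕ) : supConv id u n ∈ LipB M := by
  obtain ⟨hu, C, hC⟩ := hu
  cases isEmpty_or_nonempty M
  · exact ⟨⟨0, fun x => isEmptyElim x⟩, 0, fun x => isEmptyElim x⟩
  · refine ⟨⟨n, lipschitzWith_supConv hC n⟩, C, fun x => abs_le.2 ⟨?_, supConv_le hC n x⟩⟩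
    exact (abs_le.1 (hC x)).1.trans (le_supConv (ι := id) hC n x)

theorem exists_lipB_decreasesTo (hu : BC u) : ∃ w : ℕ → M → ℝ, (∀ n, w n ∈ LipB M) ∧
    DecreasesTo w u ∧ ∀ n x, u x ≤ w n x := by
  obtain ⟨C, hC⟩ := hu.2
  refine ⟨supConv id u, supConv_mem_lipB hu, ⟨fun n x => ?_, fun x => ?_⟩,
    fun n x => le_supConv (ι := id) hC n x⟩
  · have : Nonempty M := ⟨x⟩
    exact supConv_mono hC (fun _ => le_rfl) n.le_succ x
  · exact tendsto_supConv (ι := id) Topology.IsInducing.id hu.1 hC x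

theorem exists_lipB_increasesTo (hu : BC u) : ∃ w : ℕ → M → ℝ, (∀ n, w n ∈ LipB M) ∧
    IncreasesTo w u ∧ ∀ n x, w n x ≤ u x := by
  obtain ⟨w, hw, ⟨h1, h2⟩, h3⟩ := exists_lipB_decreasesTo hu.neg
  refine ⟨fun n x => - w n x, fun n => neg_mem (hw n), ⟨fun n x => neg_le_neg (h1 n x), fun x => ?_⟩,
    fun n x => by linarith [h3 n x]⟩
  simpa using (h2 x).neg

/-- Diagonal regularization of a decreasing sequence of bounded continuous functions. -/
theorem exists_lipB_decreasesTo_diagonal {u : ℕ → M → ℝ} (hu : ∀ n, BC (u n)) {w : M → ℝ}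
    (huw : DecreasesTo u w) : ∃ b : ℕ → M → ℝ, (∀ n, b n ∈ LipB M) ∧
      DecreasesTo b w ∧ ∀ n x, u n x ≤ b n x := by
  choose C hC using fun n => (hu n).2
  have hmono : ∀ x, Antitone fun n => u n x := fun x => antitone_nat_of_succ_le fun n => huw.1 n x
  have hle : ∀ n x, u n x ≤ supConv id (u n) n x := fun n x => le_supConv (ι := id) (hC n) n x
  refine ⟨fun n => supConv id (u n) n, fun n => supConv_mem_lipB (hu n) n,
    ⟨fun n x => ?_, fun x => ?_⟩, hle⟩
  · have : Nonempty M := ⟨x⟩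
    exact supConv_mono (hC n) (huw.1 n) n.le_succ x
  · have : Nonempty M := ⟨x⟩
    refine tendsto_order.2 ⟨fun a ha => ?_, fun a ha => ?_⟩
    · filter_upwards [(tendsto_order.1 (huw.2 x)).1 a ha] with n hn
      exact hn.trans_le (hle n x)
    -- A fixed index `m` controls the diagonal: for `n ≥ m` the sup-convolution of `u n` at level
    -- `n` is at most that of `u m`, whose limit `u m x` is already below `a`.
    · obtain ⟨m, hm⟩ := ((tendsto_order.1 (huw.2 x)).2 a ha).exists
      have := (tendsto_order.1 (tendsto_supConv (ι := id) Topology.IsInducing.id (hu m).1 (hC m) x)).2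
        a hm
      filter_upwards [this, eventually_ge_atTop m] with n hn hmn
      exact (supConv_mono (hC m) (fun y => hmono y hmn) le_rfl x).trans_lt hn

end LipB

/-! ### The operators `𝓔_h` and their compositions -/

/-! ### The weighted norm and the Lipschitz seminorm in terms of real inequalities -/

section WeightedNorm

variable {M : Type*} [MetricSpace M] {κ : Weight M} {u v : M → ℝ}

theorem LipB.le_UC : LipB M ≤ UC κ := by
  intro u hu
  refine ⟨⟨hu.1.choose_spec.continuous, ?_⟩, fun ε hε => ⟨u, hu, by simpa [wNorm] using hε⟩⟩
  obtain ⟨C, hC⟩ := hu.2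
  obtain ⟨D, hD⟩ := κ.bounded
  refine lt_of_le_of_lt (iSup_le fun x => ?_) (ENNReal.ofReal_lt_top (r := D * C))
  rw [Real.enorm_eq_ofReal_abs, abs_mul, abs_of_pos (κ.pos x)]
  exact ENNReal.ofReal_le_ofReal (mul_le_mul (hD x) (hC x) (abs_nonneg _) ((κ.pos x).le.trans (hD x)))

theorem le_wNorm (u : M → ℝ) (x : M) : ‖κ.toFun x * u x‖ₑ ≤ wNorm κ u :=
  le_iSup (fun x => ‖κ.toFun x * u x‖ₑ) x

theorem wNorm_le_ofReal {N : ℝ} (h : ∀ x, κ.toFun x * |u x| ≤ N) : wNorm κ u ≤ ENNReal.ofReal N := by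
  refine iSup_le fun x => ?_
  rw [Real.enorm_eq_ofReal_abs, abs_mul, abs_of_pos (κ.pos x)]
  exact ENNReal.ofReal_le_ofReal (h x)

theorem mul_abs_le_of_wNorm_le {N : ℝ} (hN : 0 ≤ N) (h : wNorm κ u ≤ ENNReal.ofReal N) (x : M) :
    κ.toFun x * |u x| ≤ N := by
  have := (le_wNorm (κ := κ) u x).trans h
  rwa [Real.enorm_eq_ofReal_abs, abs_mul, abs_of_pos (κ.pos x), ENNReal.ofReal_le_ofReal_iff hN] at this

theorem wNorm_sub_comm (u v : M → ℝ) : wNorm κ (u - v) = wNorm κ (v - u) := by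
  refine iSup_congr fun x => ?_
  rw [Pi.sub_apply, Pi.sub_apply, ← neg_sub (v x), mul_neg, enorm_neg]

/-- A function that is approximated in `‖·‖_κ` by continuous functions is continuous. -/
theorem continuous_of_wNorm_approx
    (h : ∀ ε : ℝ, 0 < ε → ∃ v, Continuous v ∧ ∀ x, κ.toFun x * |u x - v x| ≤ ε) : Continuous u := by
  refine continuous_of_locally_uniform_approx_of_continuousAt fun x V hV => ?_
  obtain ⟨ε, hε, hεV⟩ := Metric.mem_uniformity_dist.1 hV
  -- Near `x` the weight exceeds `κ x / 2`, so this weighted tolerance gives an unweighted error of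
  -- at most `ε / 2` there.
  obtain ⟨v, hv, huv⟩ := h (κ.toFun x / 2 * (ε / 2)) (by have := κ.pos x; positivity)
  refine ⟨{y | κ.toFun x / 2 < κ.toFun y}, ?_, v, hv.continuousAt, fun y hy => hεV ?_⟩
  · exact continuousAt_const.eventually_lt κ.continuous_toFun.continuousAt (half_lt_self (κ.pos x))
  · have hκ := κ.pos x
    have hy : κ.toFun x / 2 < κ.toFun y := hy
    have h1 : κ.toFun x / 2 * |u y - v y| ≤ κ.toFun x / 2 * (ε / 2) :=
      (mul_le_mul_of_nonneg_right hy.le (abs_nonneg _)).trans (huv y)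
    have h2 := le_of_mul_le_mul_left h1 (by positivity)
    rw [Real.dist_eq]
    linarith

/-- A bounded function that is approximated in `‖·‖_κ` by `Lip_b` belongs to `UC_κ`. -/
theorem mem_UC_of_approx (hu : ∃ C, ∀ x, |u x| ≤ C)
    (h : ∀ ε : ℝ, 0 < ε → ∃ v ∈ LipB M, ∀ x, κ.toFun x * |u x - v x| ≤ ε) : u ∈ UC κ := by
  refine ⟨⟨continuous_of_wNorm_approx (κ := κ) fun ε hε => ?_, ?_⟩, fun ε hε => ?_⟩
  · obtain ⟨v, hv, huv⟩ := h ε hε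
    exact ⟨v, hv.1.choose_spec.continuous, huv⟩
  · obtain ⟨C, hC⟩ := hu
    obtain ⟨D, hD⟩ := κ.bounded
    refine (wNorm_le_ofReal (N := D * C) fun x => ?_).trans_lt ENNReal.ofReal_lt_top
    exact mul_le_mul (hD x) (hC x) (abs_nonneg _) ((κ.pos x).le.trans (hD x))
  · obtain ⟨r, -, hr0, hr⟩ := ENNReal.lt_iff_exists_real_btwn.1 hε
    obtain ⟨v, hv, huv⟩ := h r (by simpa using hr0)
    exact ⟨v, hv, (wNorm_le_ofReal huv).trans_lt hr⟩

theorem exists_lipB_approx (hu : u ∈ UC κ) {ε : ℝ} (hε : 0 < ε) :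
    ∃ v ∈ LipB M, ∀ x, κ.toFun x * |u x - v x| ≤ ε := by
  obtain ⟨v, hv, h⟩ := hu.2 (ENNReal.ofReal ε) (by simpa using hε)
  exact ⟨v, hv, mul_abs_le_of_wNorm_le hε.le h.le⟩

theorem lipNorm_le {L : ℝ≥0} (h : LipschitzWith L u) : lipNorm u ≤ L := iInf₂_le L h

/-- The infimum defining `lipNorm` is attained: for each pair of points, use constants slightly
above `L`. The excess is scaled by `dist x y + 1`, not `dist x y`, so that coinciding points cause
no division by zero. -/
theorem lipschitzWith_of_lipNorm_le {L : ℝ≥0} (h : lipNorm u ≤ L) : LipschitzWith L u := by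
  refine LipschitzWith.of_dist_le_mul fun x y => le_of_forall_pos_le_add fun ε hε => ?_
  have hd : 0 < dist x y + 1 := by positivity
  have hlt : lipNorm u < (L + (ε / (dist x y + 1)).toNNReal : ℝ≥0) := by
    refine h.trans_lt ?_
    have : 0 < (ε / (dist x y + 1)).toNNReal := Real.toNNReal_pos.2 (by positivity)
    exact_mod_cast lt_add_of_pos_right L this
  obtain ⟨K, hK⟩ := iInf_lt_iff.1 hlt
  obtain ⟨hK', hKL⟩ := iInf_lt_iff.1 hK
  have hKL : K < L + (ε / (dist x y + 1)).toNNReal := by exact_mod_cast hKL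
  have h1 : (K : ℝ) ≤ L + ε / (dist x y + 1) := by
    have := NNReal.coe_le_coe.2 hKL.le
    rwa [NNReal.coe_add, Real.coe_toNNReal _ (by positivity)] at this
  have h2 : ε / (dist x y + 1) * dist x y ≤ ε := by
    rw [div_mul_eq_mul_div, div_le_iff₀ hd]
    nlinarith
  calc dist (u x) (u y) ≤ K * dist x y := hK'.dist_le_mul x y
    _ ≤ (L + ε / (dist x y + 1)) * dist x y := by gcongr
    _ ≤ L * dist x y + ε := by linarith

end WeightedNorm

/-- The bounded functions in `UC_κ`. -/
def UCB {M : Type*} [MetricSpace M] (κ : Weight M) : Submodule ℝ (M → ℝ) where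
  carrier := {u | u ∈ UC κ ∧ ∃ C : ℝ, ∀ x, |u x| ≤ C}
  zero_mem' := ⟨zero_mem _, 0, fun x => by simp⟩
  add_mem' := by
    rintro u v ⟨hu, C, hC⟩ ⟨hv, D, hD⟩
    exact ⟨add_mem hu hv, C + D, fun x => (abs_add_le _ _).trans (add_le_add (hC x) (hD x))⟩
  smul_mem' := by
    rintro c u ⟨hu, C, hC⟩
    refine ⟨Submodule.smul_mem _ c hu, |c| * C, fun x => ?_⟩
    simp only [Pi.smul_apply, smul_eq_mul, abs_mul]
    exact mul_le_mul_of_nonneg_left (hC x) (abs_nonneg c)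

theorem LipB.le_UCB {M : Type*} [MetricSpace M] {κ : Weight M} : LipB M ≤ UCB κ :=
  fun _ hu => ⟨LipB.le_UC hu, hu.2⟩

section SupOp

variable {M Λ : Type*} [MetricSpace M] {κ : Weight M} {S : Λ → ℝ≥0 → UC κ →ₗ[ℝ] UC κ}
  {u v : M → ℝ} {C : ℝ}

/-- Compare `u` with the constant `C`, which the semigroup fixes. -/
theorem IsLinearFellerFamily.apply_le (hS : IsLinearFellerFamily κ S) (l : Λ) (h : ℝ≥0) (u : UC κ)
    (hC : ∀ x, (u : M → ℝ) x ≤ C) (x : M) : (S l h u : M → ℝ) x ≤ C := by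
  have h1 : S l h (C • oneUC κ) = C • oneUC κ := by rw [map_smul, (hS l).2]
  have h2 := (hS l).1.monotone h u (C • oneUC κ) (fun y => by simpa [oneUC] using hC y) x
  rw [h1] at h2
  simpa [oneUC] using h2

theorem IsLinearFellerFamily.abs_apply_le (hS : IsLinearFellerFamily κ S) (l : Λ) (h : ℝ≥0)
    (u : UC κ) (hC : ∀ x, |(u : M → ℝ) x| ≤ C) (x : M) : |(S l h u : M → ℝ) x| ≤ C := by
  have h1 := hS.apply_le l h (-u) (C := C) (fun y => by
    simpa using (neg_le.1 (abs_le.1 (hC y)).1)) x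
  rw [map_neg] at h1
  have h2 : -(S l h u : M → ℝ) x ≤ C := by simpa using h1
  exact abs_le.2 ⟨by linarith, hS.apply_le l h u (fun y => (abs_le.1 (hC y)).2) x⟩

/-- The exponential bound in `‖·‖_κ` extends from `Lip_b` to its closure `UC_κ`. -/
theorem wNorm_apply_le (hS : IsLinearFellerFamily κ S) {a : ℝ} {l : Λ} {h : ℝ≥0}
    (hb : ∀ u : UC κ, (u : M → ℝ) ∈ LipB M →
      wNorm κ (S l h u : M → ℝ) ≤ ENNReal.ofReal a * wNorm κ (u : M → ℝ)) (u : UC κ) :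
    wNorm κ (S l h u : M → ℝ) ≤ ENNReal.ofReal a * wNorm κ (u : M → ℝ) := by
  refine ENNReal.le_of_forall_pos_le_add fun ε hε _ => ?_
  obtain ⟨δ, hδ, H⟩ := (hS l).1.continuous h u (ε / 2 : ℝ≥0) (by exact_mod_cast half_pos hε)
  -- The approximant must be within `δ` for continuity and within this radius for the norm estimate.
  -- The added `1` keeps the divisor nonzero when `ENNReal.ofReal a` vanishes.
  have hη : (0 : ℝ≥0∞) < (ε / 2 : ℝ≥0) / (ENNReal.ofReal a + 1) :=
    ENNReal.div_pos (by exact_mod_cast (half_pos hε).ne') (by simp)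
  obtain ⟨v, hv, huv⟩ := u.2.2 _ (lt_min hδ hη)
  have huv1 := huv.trans_le (min_le_left _ _)
  have huv2 := huv.le.trans (min_le_right _ _)
  have h1 := H ⟨v, LipB.le_UC hv⟩ (by rwa [wNorm_sub_comm])
  rw [wNorm_sub_comm] at h1
  have h2 : wNorm κ v ≤ wNorm κ (u : M → ℝ) + (ε / 2 : ℝ≥0) / (ENNReal.ofReal a + 1) := by
    have := wNorm_add_le κ (u : M → ℝ) (v - u)
    rw [add_sub_cancel, wNorm_sub_comm] at this
    exact this.trans (by gcongr)
  have h3 : ENNReal.ofReal a * ((ε / 2 : ℝ≥0) / (ENNReal.ofReal a + 1)) ≤ (ε / 2 : ℝ≥0) := by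
    refine (mul_le_mul_left (le_self_add (b := 1)) _).trans ?_
    rw [ENNReal.mul_div_cancel (by simp) (by simp)]
  calc wNorm κ (S l h u : M → ℝ)
      = wNorm κ ((S l h u - S l h ⟨v, LipB.le_UC hv⟩ : M → ℝ) + (S l h ⟨v, LipB.le_UC hv⟩ : UC κ)) := by
        rw [sub_add_cancel]
    _ ≤ (ε / 2 : ℝ≥0) + ENNReal.ofReal a * wNorm κ v :=
        (wNorm_add_le _ _ _).trans (add_le_add h1.le (hb _ hv))
    _ ≤ (ε / 2 : ℝ≥0) + (ENNReal.ofReal a * wNorm κ (u : M → ℝ) + (ε / 2 : ℝ≥0)) := by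
        gcongr
        refine (mul_le_mul_right h2 _).trans ?_
        rw [mul_add]
        gcongr
    _ = ENNReal.ofReal a * wNorm κ (u : M → ℝ) + ε := by
        rw [add_comm, add_assoc, ← ENNReal.coe_add, add_halves]

theorem supOp_of_mem (hu : u ∈ UC κ) (h : ℝ≥0) (x : M) :
    supOp S h u x = ⨆ l, (S l h ⟨u, hu⟩ : M → ℝ) x := dif_pos hu

/-- A sup bound on `u` passes unchanged to every `S_λ(h)u`, so on `UCB` the suprema over `Λ` are
finite without recourse to the weighted bound. -/
theorem bddAbove_apply (hS : IsLinearFellerFamily κ S) (hu : u ∈ UCB κ) (h : ℝ≥0) (x : M) :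
    BddAbove (Set.range fun l => (S l h ⟨u, hu.1⟩ : M → ℝ) x) := by
  obtain ⟨C, hC⟩ := hu.2
  refine ⟨C, ?_⟩
  rintro _ ⟨l, rfl⟩
  exact (abs_le.1 (hS.abs_apply_le l h _ hC x)).2

theorem apply_le_supOp (hS : IsLinearFellerFamily κ S) (hu : u ∈ UCB κ) (l : Λ) (h : ℝ≥0) (x : M) :
    (S l h ⟨u, hu.1⟩ : M → ℝ) x ≤ supOp S h u x := by
  rw [supOp_of_mem hu.1]
  exact le_ciSup (bddAbove_apply hS hu h x) l

variable [Nonempty Λ]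

theorem supOp_le (hu : u ∈ UC κ) {h : ℝ≥0} {x : M} {a : ℝ}
    (H : ∀ l, (S l h ⟨u, hu⟩ : M → ℝ) x ≤ a) : supOp S h u x ≤ a := by
  rw [supOp_of_mem hu]
  exact ciSup_le H

theorem supOp_mono (hS : IsLinearFellerFamily κ S) (hu : u ∈ UCB κ) (hv : v ∈ UCB κ)
    (huv : ∀ x, u x ≤ v x) (h : ℝ≥0) (x : M) : supOp S h u x ≤ supOp S h v x :=
  supOp_le hu.1 fun l =>
    ((hS l).1.monotone h ⟨u, hu.1⟩ ⟨v, hv.1⟩ huv x).trans (apply_le_supOp hS hv l h x)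

theorem supOp_abs_le (hS : IsLinearFellerFamily κ S) (hu : u ∈ UCB κ) (hC : ∀ x, |u x| ≤ C)
    (h : ℝ≥0) (x : M) : |supOp S h u x| ≤ C := by
  refine abs_le.2 ⟨?_, supOp_le hu.1 fun l => (abs_le.1 (hS.abs_apply_le l h _ hC x)).2⟩
  have l : Λ := Classical.arbitrary Λ
  exact (abs_le.1 (hS.abs_apply_le l h ⟨u, hu.1⟩ hC x)).1.trans (apply_le_supOp hS hu l h x)

theorem supOp_add_le (hS : IsLinearFellerFamily κ S) (hu : u ∈ UCB κ) (hv : v ∈ UCB κ)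
    (h : ℝ≥0) (x : M) : supOp S h (u + v) x ≤ supOp S h u x + supOp S h v x := by
  refine supOp_le (add_mem hu.1 hv.1) fun l => ?_
  have : S l h ⟨u + v, add_mem hu.1 hv.1⟩ = S l h ⟨u, hu.1⟩ + S l h ⟨v, hv.1⟩ := by
    rw [← map_add]; rfl
  rw [this]
  exact add_le_add (apply_le_supOp hS hu l h x) (apply_le_supOp hS hv l h x)

theorem supOp_smul_le (hS : IsLinearFellerFamily κ S) (hu : u ∈ UCB κ) {r : ℝ} (hr : 0 ≤ r)
    (h : ℝ≥0) (x : M) : supOp S h (r • u) x ≤ r * supOp S h u x := by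
  refine supOp_le (Submodule.smul_mem _ r hu.1) fun l => ?_
  have : S l h ⟨r • u, Submodule.smul_mem _ r hu.1⟩ = r • S l h ⟨u, hu.1⟩ := by
    rw [← map_smul]; rfl
  rw [this]
  exact mul_le_mul_of_nonneg_left (apply_le_supOp hS hu l h x) hr

theorem supOp_zero (hS : IsLinearFellerFamily κ S) (hu : u ∈ UC κ) : supOp S 0 u = u := by
  funext x
  rw [supOp_of_mem hu]
  have : ∀ l, (S l 0 ⟨u, hu⟩ : M → ℝ) x = u x := fun l => by rw [(hS l).1.zero]
  simp [this]

theorem supOp_const (hS : IsLinearFellerFamily κ S) (c : ℝ) (h : ℝ≥0) :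
    supOp S h (fun _ => c) = fun _ => c := by
  have hc : (fun _ => c) ∈ UC κ := LipB.le_UC (LipB.const_mem c)
  funext x
  have h1 : (⟨fun _ => c, hc⟩ : UC κ) = c • oneUC κ := by
    ext y
    simp [oneUC]
  have h2 : ∀ l, (S l h ⟨fun _ => c, hc⟩ : M → ℝ) x = c := fun l => by
    rw [h1, map_smul, (hS l).2]
    simp [oneUC]
  simp [supOp_of_mem hc, h2]

theorem supOp_lipschitzWith (hS : IsLinearFellerFamily κ S) {h K L : ℝ≥0}
    (hb : ∀ (u : UC κ), (u : M → ℝ) ∈ LipB M → ∀ l,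
      lipNorm (S l h u : M → ℝ) ≤ K * lipNorm (u : M → ℝ))
    (hu : u ∈ LipB M) (hL : LipschitzWith L u) : LipschitzWith (K * L) (supOp S h u) := by
  have hl : ∀ l, LipschitzWith (K * L) (S l h ⟨u, LipB.le_UC hu⟩ : M → ℝ) := fun l => by
    refine lipschitzWith_of_lipNorm_le ((hb ⟨u, LipB.le_UC hu⟩ hu l).trans ?_)
    rw [ENNReal.coe_mul]
    gcongr
    exact lipNorm_le hL
  refine LipschitzWith.of_le_add_mul _ fun x y => supOp_le (LipB.le_UC hu) fun l => ?_
  have h1 := (hl l).dist_le_mul x y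
  rw [Real.dist_eq] at h1
  have h2 := apply_le_supOp hS (LipB.le_UCB hu) l h y
  linarith [(abs_le.1 h1).2]

/-- `𝓔_h` is Lipschitz continuous in the weighted norm. -/
theorem supOp_sub_le (hS : IsLinearFellerFamily κ S) {a ε : ℝ} {h : ℝ≥0} (ha : 0 ≤ a) (hε : 0 ≤ ε)
    (hb : ∀ (u : UC κ), (u : M → ℝ) ∈ LipB M → ∀ l,
      wNorm κ (S l h u : M → ℝ) ≤ ENNReal.ofReal a * wNorm κ (u : M → ℝ))
    (hu : u ∈ UCB κ) (hv : v ∈ UCB κ) (huv : ∀ x, κ.toFun x * |u x - v x| ≤ ε) (x : M) :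
    κ.toFun x * (supOp S h u x - supOp S h v x) ≤ a * ε := by
  -- Sublinearity bounds the difference by `𝓔_h(u - v)`, to which the weighted bound for each single
  -- `S_λ(h)` applies.
  have h1 : κ.toFun x * supOp S h (u - v) x ≤ a * ε := by
    rw [mul_comm, ← le_div_iff₀ (κ.pos x)]
    have hm := sub_mem hu hv
    refine supOp_le hm.1 fun l => ?_
    rw [le_div_iff₀ (κ.pos x), mul_comm]
    have h2 := wNorm_apply_le hS (fun u hu => hb u hu l) ⟨u - v, hm.1⟩
    have h3 : wNorm κ (u - v) ≤ ENNReal.ofReal ε := wNorm_le_ofReal huv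
    have h4 := h2.trans (mul_le_mul_right h3 _)
    rw [← ENNReal.ofReal_mul ha] at h4
    exact (mul_le_mul_of_nonneg_left (le_abs_self _) (κ.pos x).le).trans
      (mul_abs_le_of_wNorm_le (mul_nonneg ha hε) h4 x)
  have h5 := supOp_add_le hS (sub_mem hu hv) hv h x
  rw [sub_add_cancel] at h5
  exact (mul_le_mul_of_nonneg_left (by linarith) (κ.pos x).le).trans h1

theorem supOp_mem_lipB (hS : IsLinearFellerFamily κ S) (hbound : HasUniformBounds κ S)
    (hu : u ∈ LipB M) (h : ℝ≥0) : supOp S h u ∈ LipB M := by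
  obtain ⟨α, β, hb⟩ := hbound
  obtain ⟨⟨L, hL⟩, C, hC⟩ := hu
  exact ⟨⟨_, supOp_lipschitzWith hS (fun u hu l => (hb u hu l h).2) ⟨⟨L, hL⟩, C, hC⟩ hL⟩, C,
    supOp_abs_le hS (LipB.le_UCB ⟨⟨L, hL⟩, C, hC⟩) hC h⟩

/-- `𝓔_h` preserves `Lip_b` and is Lipschitz in the weighted norm with constant `exp (α * h)`, hence
it preserves bounded elements of the closure. -/
theorem supOp_mem_UCB (hS : IsLinearFellerFamily κ S) (hbound : HasUniformBounds κ S)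
    (hu : u ∈ UCB κ) (h : ℝ≥0) : supOp S h u ∈ UCB κ := by
  obtain ⟨C, hC⟩ := hu.2
  have hbd : ∃ C, ∀ x, |supOp S h u x| ≤ C := ⟨C, supOp_abs_le hS hu hC h⟩
  refine ⟨mem_UC_of_approx hbd fun ε hε => ?_, hbd⟩
  obtain ⟨α, β, hb⟩ := id hbound
  set a := Real.exp (α * h)
  have ha : 0 < a := Real.exp_pos _
  have hb' : ∀ (u : UC κ), (u : M → ℝ) ∈ LipB M → ∀ l,
      wNorm κ (S l h u : M → ℝ) ≤ ENNReal.ofReal a * wNorm κ (u : M → ℝ) :=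
    fun u hu l => (hb u hu l h).1
  obtain ⟨v, hv, huv⟩ := exists_lipB_approx hu.1 (div_pos hε ha)
  have hε' : 0 ≤ ε / a := by positivity
  refine ⟨supOp S h v, supOp_mem_lipB hS hbound hv h, fun x => ?_⟩
  have h1 := supOp_sub_le hS ha.le hε' hb' hu (LipB.le_UCB hv) huv x
  have h2 := supOp_sub_le hS ha.le hε' hb' (LipB.le_UCB hv) hu
    (fun y => by rw [abs_sub_comm]; exact huv y) x
  rw [mul_div_cancel₀ _ ha.ne'] at h1 h2
  have hκ := κ.pos x
  rw [show κ.toFun x * |supOp S h u x - supOp S h v x| =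
    |κ.toFun x * (supOp S h u x - supOp S h v x)| by rw [abs_mul, abs_of_pos hκ]]
  exact abs_le.2 ⟨by linarith, h1⟩

/-- Using one `λ` over a time `a + b` is a special case of choosing `λ` afresh after `a`. This is
why refinement increases the value of a partition. -/
theorem supOp_add_time_le (hS : IsLinearFellerFamily κ S) (hbound : HasUniformBounds κ S)
    (hu : u ∈ UCB κ) (a b : ℝ≥0) (x : M) : supOp S (a + b) u x ≤ supOp S a (supOp S b u) x := by
  have hm := supOp_mem_UCB hS hbound hu b
  refine supOp_le hu.1 fun l => ?_
  have h1 : S l (a + b) ⟨u, hu.1⟩ = S l a (S l b ⟨u, hu.1⟩) := (hS l).1.add a b _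
  rw [h1]
  exact ((hS l).1.monotone a (S l b ⟨u, hu.1⟩) ⟨supOp S b u, hm.1⟩
    (fun y => apply_le_supOp hS hu l b y) x).trans (apply_le_supOp hS hm l a x)

/-- A single `λ` that is nearly optimal for `w` at `x` already does well for `u n` with `n` large,
by its own continuity from below. -/
theorem supOp_increasesTo (hS : IsLinearFellerFamily κ S) {u : ℕ → M → ℝ} {w : M → ℝ}
    (hu : ∀ n, u n ∈ UCB κ) (hw : w ∈ UCB κ) (huw : IncreasesTo u w) (h : ℝ≥0) :
    IncreasesTo (fun n => supOp S h (u n)) (supOp S h w) := by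
  have hle : ∀ n x, u n x ≤ w x := fun n x =>
    (monotone_nat_of_le_succ fun n => huw.1 n x).ge_of_tendsto (huw.2 x) n
  refine ⟨fun n x => supOp_mono hS (hu n) (hu (n + 1)) (huw.1 n) h x, fun x =>
    tendsto_order.2 ⟨fun a ha => ?_, fun a ha =>
      Eventually.of_forall fun n => (supOp_mono hS (hu n) hw (hle n) h x).trans_lt ha⟩⟩
  rw [supOp_of_mem hw.1] at ha
  obtain ⟨l, hl⟩ := exists_lt_of_lt_ciSup ha
  have := ((hS l).1.continuous_from_below h (fun n => ⟨u n, (hu n).1⟩) ⟨w, hw.1⟩ huw).2 x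
  filter_upwards [(tendsto_order.1 this).1 a hl] with n hn
  exact hn.trans_le (apply_le_supOp hS (hu n) l h x)

end SupOp

/-! ### Compositions along lists of time increments -/

/-- `𝓔_{h₁} ⋯ 𝓔_{h_m} u` for the list `[h₁, …, h_m]` of increments. -/
def incOp {M Λ : Type*} [MetricSpace M] {κ : Weight M}
    (S : Λ → ℝ≥0 → UC κ →ₗ[ℝ] UC κ) (h : List ℝ≥0) (u : M → ℝ) : M → ℝ :=
  h.foldr (supOp S) u

section IncOp

variable {M Λ : Type*} [MetricSpace M] {κ : Weight M} {S : Λ → ℝ≥0 → UC κ →ₗ[ℝ] UC κ}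
  {u v : M → ℝ} {C : ℝ}

@[simp] theorem incOp_nil (u : M → ℝ) : incOp S [] u = u := rfl

@[simp] theorem incOp_cons (a : ℝ≥0) (h : List ℝ≥0) (u : M → ℝ) :
    incOp S (a :: h) u = supOp S a (incOp S h u) := rfl

theorem incOp_append (h k : List ℝ≥0) (u : M → ℝ) :
    incOp S (h ++ k) u = incOp S h (incOp S k u) := by simp [incOp]

variable [Nonempty Λ]

theorem incOp_mem_UCB (hS : IsLinearFellerFamily κ S) (hbound : HasUniformBounds κ S)
    (hu : u ∈ UCB κ) (h : List ℝ≥0) : incOp S h u ∈ UCB κ := by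
  induction h with
  | nil => exact hu
  | cons a h ih => exact supOp_mem_UCB hS hbound ih a

theorem incOp_mem_lipB (hS : IsLinearFellerFamily κ S) (hbound : HasUniformBounds κ S)
    (hu : u ∈ LipB M) (h : List ℝ≥0) : incOp S h u ∈ LipB M := by
  induction h with
  | nil => exact hu
  | cons a h ih => exact supOp_mem_lipB hS hbound ih a

theorem incOp_abs_le (hS : IsLinearFellerFamily κ S) (hbound : HasUniformBounds κ S)
    (hu : u ∈ UCB κ) (hC : ∀ x, |u x| ≤ C) (h : List ℝ≥0) (x : M) : |incOp S h u x| ≤ C := by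
  induction h generalizing x with
  | nil => exact hC x
  | cons a h ih => exact supOp_abs_le hS (incOp_mem_UCB hS hbound hu h) ih a x

theorem incOp_mono (hS : IsLinearFellerFamily κ S) (hbound : HasUniformBounds κ S)
    (hu : u ∈ UCB κ) (hv : v ∈ UCB κ) (huv : ∀ x, u x ≤ v x) (h : List ℝ≥0) (x : M) :
    incOp S h u x ≤ incOp S h v x := by
  induction h generalizing x with
  | nil => exact huv x
  | cons a h ih =>
    exact supOp_mono hS (incOp_mem_UCB hS hbound hu h) (incOp_mem_UCB hS hbound hv h) ih a x

theorem incOp_add_le (hS : IsLinearFellerFamily κ S) (hbound : HasUniformBounds κ S)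
    (hu : u ∈ UCB κ) (hv : v ∈ UCB κ) (h : List ℝ≥0) (x : M) :
    incOp S h (u + v) x ≤ incOp S h u x + incOp S h v x := by
  induction h generalizing x with
  | nil => exact le_rfl
  | cons a h ih =>
    have hu' := incOp_mem_UCB hS hbound hu h
    have hv' := incOp_mem_UCB hS hbound hv h
    exact (supOp_mono hS (incOp_mem_UCB hS hbound (add_mem hu hv) h) (add_mem hu' hv') ih a x).trans
      (supOp_add_le hS hu' hv' a x)

theorem incOp_smul_le (hS : IsLinearFellerFamily κ S) (hbound : HasUniformBounds κ S)
    (hu : u ∈ UCB κ) {r : ℝ} (hr : 0 ≤ r) (h : List ℝ≥0) (x : M) :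
    incOp S h (r • u) x ≤ r * incOp S h u x := by
  induction h generalizing x with
  | nil => exact le_rfl
  | cons a h ih =>
    have hu' := incOp_mem_UCB hS hbound hu h
    exact (supOp_mono hS (incOp_mem_UCB hS hbound (Submodule.smul_mem _ r hu) h)
      (Submodule.smul_mem _ r hu') ih a x).trans (supOp_smul_le hS hu' hr a x)

theorem incOp_increasesTo (hS : IsLinearFellerFamily κ S) (hbound : HasUniformBounds κ S)
    {u : ℕ → M → ℝ} {w : M → ℝ} (hu : ∀ n, u n ∈ UCB κ) (hw : w ∈ UCB κ) (huw : IncreasesTo u w)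
    (h : List ℝ≥0) : IncreasesTo (fun n => incOp S h (u n)) (incOp S h w) := by
  induction h with
  | nil => exact huw
  | cons a h ih =>
    exact supOp_increasesTo hS (fun n => incOp_mem_UCB hS hbound (hu n) h)
      (incOp_mem_UCB hS hbound hw h) ih a

/-- The factors `exp (β * a)` of the increments multiply to `exp (β * t)`, which does not see the
partition. -/
theorem incOp_lipschitzWith (hS : IsLinearFellerFamily κ S) (hbound : HasUniformBounds κ S)
    (hu : u ∈ LipB M) (t : ℝ≥0) :
    ∃ L : ℝ≥0, ∀ h : List ℝ≥0, h.sum = t → LipschitzWith L (incOp S h u) := by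
  obtain ⟨α, β, hb⟩ := id hbound
  obtain ⟨L, hL⟩ := hu.1
  have key : ∀ h : List ℝ≥0, LipschitzWith ((Real.exp (β * h.sum)).toNNReal * L) (incOp S h u) := by
    intro h
    induction h with
    | nil => simpa using hL
    | cons a h ih =>
      have := supOp_lipschitzWith hS (fun u hu l => (hb u hu l a).2) (incOp_mem_lipB hS hbound hu h) ih
      refine this.weaken (le_of_eq ?_)
      rw [List.sum_cons, NNReal.coe_add, mul_add, Real.exp_add,
        Real.toNNReal_mul (Real.exp_pos _).le, mul_assoc]
  exact ⟨_, fun h hh => hh ▸ key h⟩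

theorem incOp_of_sum_eq_zero (hS : IsLinearFellerFamily κ S) (hu : u ∈ UC κ) {h : List ℝ≥0}
    (hh : h.sum = 0) : incOp S h u = u := by
  induction h with
  | nil => rfl
  | cons a h ih =>
    rw [List.sum_cons, add_eq_zero] at hh
    rw [incOp_cons, ih hh.2, hh.1, supOp_zero hS hu]

theorem incOp_const (hS : IsLinearFellerFamily κ S) (c : ℝ) (h : List ℝ≥0) :
    incOp S h (fun _ => c) = fun _ => c := by
  induction h with
  | nil => rfl
  | cons a h ih => rw [incOp_cons, ih, supOp_const hS]

/-- Two lists of increments with the same sum have a common refinement. -/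
theorem exists_incOp_refinement (hS : IsLinearFellerFamily κ S) (hbound : HasUniformBounds κ S)
    (hu : u ∈ UCB κ) (n : ℕ) (h k : List ℝ≥0) (hn : h.length + k.length ≤ n) (hk : h.sum = k.sum) :
    ∃ m : List ℝ≥0, m.sum = h.sum ∧ (∀ x, incOp S h u x ≤ incOp S m u x) ∧
      ∀ x, incOp S k u x ≤ incOp S m u x := by
  induction n generalizing h k with
  | zero =>
    have h0 : h = [] := List.length_eq_zero_iff.1 (by omega)
    have k0 : k = [] := List.length_eq_zero_iff.1 (by omega)
    subst h0 k0
    exact ⟨[], rfl, fun _ => le_rfl, fun _ => le_rfl⟩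
  | succ n ih =>
    -- If the first increments satisfy `b = a + c`, cutting `b` into `a` and `c` can only increase
    -- the value. After the common `a`, the lists `h` and `c :: k` remain, with one entry fewer in
    -- total. Induction is on a bound for the total length because either list may be the one that
    -- is cut.
    have step : ∀ (a b : ℝ≥0) (h k : List ℝ≥0), a ≤ b → h.length + k.length + 1 ≤ n →
        (a :: h).sum = (b :: k).sum → ∃ m : List ℝ≥0, m.sum = (a :: h).sum ∧
          (∀ x, incOp S (a :: h) u x ≤ incOp S m u x) ∧
          ∀ x, incOp S (b :: k) u x ≤ incOp S m u x := by
      intro a b h k hab hlen hsum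
      obtain ⟨c, rfl⟩ := exists_add_of_le hab
      rw [List.sum_cons, List.sum_cons, add_assoc, add_right_inj] at hsum
      obtain ⟨m, hm, h1, h2⟩ := ih h (c :: k) (by simp; omega) (by simpa using hsum)
      have hmem := fun l => incOp_mem_UCB hS hbound hu l
      refine ⟨a :: m, by simp [hm], supOp_mono hS (hmem h) (hmem m) h1 a, fun x => ?_⟩
      exact (supOp_add_time_le hS hbound (hmem k) a c x).trans
        (supOp_mono hS (hmem (c :: k)) (hmem m) h2 a x)
    match h, k with
    | [], k =>
      refine ⟨k, hk.symm, fun x => ?_, fun _ => le_rfl⟩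
      rw [incOp_of_sum_eq_zero hS hu.1 (h := k) (by simpa using hk.symm), incOp_nil]
    | a :: h, [] =>
      refine ⟨a :: h, rfl, fun _ => le_rfl, fun x => ?_⟩
      rw [incOp_of_sum_eq_zero hS hu.1 (h := a :: h) hk, incOp_nil]
    | a :: h, b :: k =>
      simp only [List.length_cons] at hn
      rcases le_total a b with hab | hab
      · exact step a b h k hab (by omega) hk
      · obtain ⟨m, hm, h1, h2⟩ := step b a k h hab (by omega) hk.symm
        exact ⟨m, hm.trans hk.symm, h2, h1⟩

/-- A list of increments can be split at any intermediate time. -/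
theorem exists_incOp_split (hS : IsLinearFellerFamily κ S) (hbound : HasUniformBounds κ S)
    (hu : u ∈ UCB κ) (h : List ℝ≥0) (s t : ℝ≥0) (hst : h.sum = s + t) :
    ∃ h₁ h₂ : List ℝ≥0, h₁.sum = s ∧ h₂.sum = t ∧
      ∀ x, incOp S h u x ≤ incOp S h₁ (incOp S h₂ u) x := by
  have hmem := fun l => incOp_mem_UCB hS hbound hu l
  induction h generalizing s with
  | nil =>
    obtain ⟨rfl, rfl⟩ := add_eq_zero.1 hst.symm
    exact ⟨[], [], rfl, rfl, fun _ => le_rfl⟩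
  | cons a h ih =>
    rcases le_total a s with has | has
    · obtain ⟨c, rfl⟩ := exists_add_of_le has
      rw [List.sum_cons, add_assoc, add_right_inj] at hst
      obtain ⟨h₁, h₂, rfl, rfl, hle⟩ := ih c hst
      exact ⟨a :: h₁, h₂, by simp, rfl,
        supOp_mono hS (hmem h) (incOp_mem_UCB hS hbound (hmem h₂) h₁) hle a⟩
    · obtain ⟨c, rfl⟩ := exists_add_of_le has
      rw [List.sum_cons, add_assoc, add_right_inj] at hst
      exact ⟨[s], c :: h, by simp, by simpa using hst, supOp_add_time_le hS hbound (hmem h) s c⟩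

end IncOp

/-! ### The envelope in terms of increments -/

section Envelope

variable {M Λ : Type*} [MetricSpace M] {κ : Weight M} {S : Λ → ℝ≥0 → UC κ →ₗ[ℝ] UC κ}
  {u v : M → ℝ} {C : ℝ}

theorem exists_incOp_eq_listOp (a : ℝ≥0) (l : List ℝ≥0) (hl : (a :: l).Pairwise (· < ·))
    (u : M → ℝ) : ∃ h : List ℝ≥0, a + h.sum = (a :: l).getLast (by simp) ∧
      listOp S (a :: l) u = incOp S h u := by
  induction l generalizing a with
  | nil => exact ⟨[], by simp, rfl⟩
  | cons b l ih =>
    obtain ⟨h, h1, h2⟩ := ih b (List.pairwise_cons.1 hl).2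
    have hab : a ≤ b := ((List.pairwise_cons.1 hl).1 b (by simp)).le
    refine ⟨(b - a) :: h, ?_, ?_⟩
    · rw [List.sum_cons, ← add_assoc, add_tsub_cancel_of_le hab, h1]
      simp
    · rw [incOp_cons, ← h2, listOp]

/-- A strictly increasing list of times has no zero increments; those in `h` are dropped because
`𝓔_0` is the identity. -/
theorem exists_listOp_eq_incOp [Nonempty Λ] (hS : IsLinearFellerFamily κ S)
    (hbound : HasUniformBounds κ S) (hu : u ∈ UCB κ) (h : List ℝ≥0) (a : ℝ≥0) :
    ∃ l : List ℝ≥0, (a :: l).Pairwise (· < ·) ∧ (a :: l).getLast (by simp) = a + h.sum ∧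
      listOp S (a :: l) u = incOp S h u := by
  induction h generalizing a with
  | nil => exact ⟨[], by simp, by simp, rfl⟩
  | cons b h ih =>
    rcases eq_or_ne b 0 with rfl | hb
    · obtain ⟨l, h1, h2, h3⟩ := ih a
      refine ⟨l, h1, by simpa using h2, ?_⟩
      rw [h3, incOp_cons, supOp_zero hS (incOp_mem_UCB hS hbound hu h).1]
    · obtain ⟨l, h1, h2, h3⟩ := ih (a + b)
      have hab : a < a + b := lt_add_of_pos_right a (pos_iff_ne_zero.2 hb)
      refine ⟨(a + b) :: l, ?_, ?_, ?_⟩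
      · refine List.pairwise_cons.2 ⟨fun c hc => ?_, h1⟩
        rcases List.mem_cons.1 hc with rfl | hc
        · exact hab
        · exact hab.trans ((List.pairwise_cons.1 h1).1 c hc)
      · rw [List.getLast_cons (by simp), h2, List.sum_cons, add_assoc]
      · rw [incOp_cons, ← h3, listOp, add_tsub_cancel_left]

theorem le_getLast_of_pairwise {l : List ℝ≥0} (hl : l.Pairwise (· < ·)) (hne : l ≠ []) {b : ℝ≥0}
    (hb : b ∈ l) : b ≤ l.getLast hne := by
  induction l with
  | nil => exact absurd rfl hne
  | cons c l ih =>
    rcases eq_or_ne l [] with rfl | hl'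
    · rw [List.mem_singleton] at hb
      simp [hb]
    · rw [List.getLast_cons hl']
      rcases List.mem_cons.1 hb with rfl | hb
      · exact ((List.pairwise_cons.1 hl).1 _ (List.getLast_mem hl')).le
      · exact ih (List.pairwise_cons.1 hl).2 hl' hb

/-- This replaces absolute times by increments, which compose by concatenation and may be cut or
padded with zeros freely. -/
theorem range_partOp_eq [Nonempty Λ] (hS : IsLinearFellerFamily κ S)
    (hbound : HasUniformBounds κ S) (hu : u ∈ UCB κ) (t : ℝ≥0) (x : M) :
    (Set.range fun π : Partitions t => partOp S (π : Finset ℝ≥0) u x) =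
      Set.range fun h : {h : List ℝ≥0 // h.sum = t} => incOp S h u x := by
  ext r
  constructor
  · rintro ⟨⟨π, h0, hmem, hmax⟩, rfl⟩
    have hsort : (π.sort (· ≤ ·)).Pairwise (· < ·) := (π.sortedLT_sort).pairwise
    have h0' : (0 : ℝ≥0) ∈ π.sort (· ≤ ·) := (Finset.mem_sort _).2 h0
    obtain ⟨a, l, hal⟩ : ∃ a l, π.sort (· ≤ ·) = a :: l :=
      List.exists_cons_of_ne_nil (List.ne_nil_of_mem h0')
    have hmem_iff : ∀ b, b ∈ a :: l ↔ b ∈ π := fun b => by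
      rw [← hal]; exact Finset.mem_sort _
    rw [hal] at hsort h0'
    have ha : a = 0 := by
      rcases List.mem_cons.1 h0' with h | h
      · exact h.symm
      · exact absurd ((List.pairwise_cons.1 hsort).1 0 h) not_lt_zero
    obtain ⟨h, h1, h2⟩ := exists_incOp_eq_listOp (S := S) a l hsort u
    have hlast : (a :: l).getLast (by simp) = t := by
      exact le_antisymm (hmax ((hmem_iff _).1 (List.getLast_mem _)))
        (le_getLast_of_pairwise hsort _ ((hmem_iff t).2 hmem))
    refine ⟨⟨h, by rw [← hlast, ← h1, ha, zero_add]⟩, ?_⟩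
    simp only [partOp, hal, h2]
  · rintro ⟨⟨h, rfl⟩, rfl⟩
    obtain ⟨l, h1, h2, h3⟩ := exists_listOp_eq_incOp hS hbound hu h 0
    rw [zero_add] at h2
    refine ⟨⟨(0 :: l).toFinset, by simp, ?_, ?_⟩, ?_⟩
    · rw [← h2]
      simpa only [Finset.mem_coe, List.mem_toFinset] using List.getLast_mem (l := 0 :: l) (by simp)
    · intro b hb
      rw [← h2]
      exact le_getLast_of_pairwise h1 _ (by simpa only [Finset.mem_coe, List.mem_toFinset] using hb)
    · have hsort : (0 :: l).toFinset.sort (· ≤ ·) = 0 :: l :=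
        (List.toFinset_sort (· ≤ ·) (h1.imp fun h => h.ne)).2 (h1.imp fun h => h.le)
      simp only [partOp, hsort, h3]

variable [Nonempty Λ]

theorem envelope_eq_iSup (hS : IsLinearFellerFamily κ S)
    (hbound : HasUniformBounds κ S) (hu : u ∈ UCB κ) (t : ℝ≥0) (x : M) :
    envelope S t u x = ⨆ h : {h : List ℝ≥0 // h.sum = t}, incOp S h u x :=
  congrArg sSup (range_partOp_eq hS hbound hu t x)

theorem bddAbove_incOp (hS : IsLinearFellerFamily κ S)
    (hbound : HasUniformBounds κ S) (hu : u ∈ UCB κ) (t : ℝ≥0) (x : M) :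
    BddAbove (Set.range fun h : {h : List ℝ≥0 // h.sum = t} => incOp S h u x) := by
  obtain ⟨C, hC⟩ := hu.2
  refine ⟨C, ?_⟩
  rintro _ ⟨h, rfl⟩
  exact (abs_le.1 (incOp_abs_le hS hbound hu hC h x)).2

theorem incOp_le_envelope (hS : IsLinearFellerFamily κ S) (hbound : HasUniformBounds κ S)
    (hu : u ∈ UCB κ) {t : ℝ≥0} {h : List ℝ≥0} (hh : h.sum = t) (x : M) :
    incOp S h u x ≤ envelope S t u x := by
  rw [envelope_eq_iSup hS hbound hu]
  exact le_ciSup (bddAbove_incOp hS hbound hu t x) ⟨h, hh⟩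

instance nonempty_increments (t : ℝ≥0) : Nonempty {h : List ℝ≥0 // h.sum = t} := ⟨[t], by simp⟩

theorem envelope_le (hS : IsLinearFellerFamily κ S) (hbound : HasUniformBounds κ S)
    (hu : u ∈ UCB κ) {t : ℝ≥0} {x : M} {r : ℝ}
    (H : ∀ h : List ℝ≥0, h.sum = t → incOp S h u x ≤ r) : envelope S t u x ≤ r := by
  rw [envelope_eq_iSup hS hbound hu]
  exact ciSup_le fun h => H h h.2

theorem envelope_abs_le (hS : IsLinearFellerFamily κ S) (hbound : HasUniformBounds κ S)
    (hu : u ∈ UCB κ) (hC : ∀ x, |u x| ≤ C) (t : ℝ≥0) (x : M) : |envelope S t u x| ≤ C := by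
  refine abs_le.2 ⟨?_, envelope_le hS hbound hu fun h _ =>
    (abs_le.1 (incOp_abs_le hS hbound hu hC h x)).2⟩
  exact (abs_le.1 (incOp_abs_le hS hbound hu hC [t] x)).1.trans
    (incOp_le_envelope hS hbound hu (by simp) x)

theorem envelope_mono (hS : IsLinearFellerFamily κ S) (hbound : HasUniformBounds κ S)
    (hu : u ∈ UCB κ) (hv : v ∈ UCB κ) (huv : ∀ x, u x ≤ v x) (t : ℝ≥0) (x : M) :
    envelope S t u x ≤ envelope S t v x :=
  envelope_le hS hbound hu fun h hh =>
    (incOp_mono hS hbound hu hv huv h x).trans (incOp_le_envelope hS hbound hv hh x)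

theorem envelope_add_le (hS : IsLinearFellerFamily κ S) (hbound : HasUniformBounds κ S)
    (hu : u ∈ UCB κ) (hv : v ∈ UCB κ) (t : ℝ≥0) (x : M) :
    envelope S t (u + v) x ≤ envelope S t u x + envelope S t v x :=
  envelope_le hS hbound (add_mem hu hv) fun h hh =>
    (incOp_add_le hS hbound hu hv h x).trans (add_le_add (incOp_le_envelope hS hbound hu hh x)
      (incOp_le_envelope hS hbound hv hh x))

theorem envelope_smul_le (hS : IsLinearFellerFamily κ S) (hbound : HasUniformBounds κ S)
    (hu : u ∈ UCB κ) {r : ℝ} (hr : 0 ≤ r) (t : ℝ≥0) (x : M) :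
    envelope S t (r • u) x ≤ r * envelope S t u x :=
  envelope_le hS hbound (Submodule.smul_mem _ r hu) fun h hh =>
    (incOp_smul_le hS hbound hu hr h x).trans
      (mul_le_mul_of_nonneg_left (incOp_le_envelope hS hbound hu hh x) hr)

theorem envelope_const (hS : IsLinearFellerFamily κ S) (hbound : HasUniformBounds κ S) (c : ℝ)
    (t : ℝ≥0) : envelope S t (fun _ => c) = fun _ => c := by
  funext x
  rw [envelope_eq_iSup hS hbound (LipB.le_UCB (LipB.const_mem c))]
  simp [incOp_const hS]

theorem envelope_zero (hS : IsLinearFellerFamily κ S) (hbound : HasUniformBounds κ S)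
    (hu : u ∈ UCB κ) : envelope S 0 u = u := by
  funext x
  refine le_antisymm (envelope_le hS hbound hu fun h hh => ?_) ?_
  · rw [incOp_of_sum_eq_zero hS hu.1 hh]
  · exact incOp_le_envelope hS hbound hu (h := []) rfl x

/-- One constant serves the envelope and all compositions of total length `t`; this equicontinuity
lets a dense sequence of points control all of `M`. -/
theorem envelope_lipschitzWith (hS : IsLinearFellerFamily κ S) (hbound : HasUniformBounds κ S)
    (hu : u ∈ LipB M) (t : ℝ≥0) : ∃ L : ℝ≥0, LipschitzWith L (envelope S t u) ∧
      ∀ h : List ℝ≥0, h.sum = t → LipschitzWith L (incOp S h u) := by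
  obtain ⟨L, hL⟩ := incOp_lipschitzWith hS hbound hu t
  have hu' := LipB.le_UCB (κ := κ) hu
  refine ⟨L, LipschitzWith.of_le_add_mul _ fun x y => envelope_le hS hbound hu' fun h hh => ?_, hL⟩
  have h1 := (hL h hh).dist_le_mul x y
  rw [Real.dist_eq] at h1
  linarith [(abs_le.1 h1).2, incOp_le_envelope hS hbound hu' hh y]

theorem envelope_mem_lipB (hS : IsLinearFellerFamily κ S) (hbound : HasUniformBounds κ S)
    (hu : u ∈ LipB M) (t : ℝ≥0) : envelope S t u ∈ LipB M := by
  obtain ⟨L, hL, -⟩ := envelope_lipschitzWith hS hbound hu t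
  obtain ⟨C, hC⟩ := hu.2
  exact ⟨⟨L, hL⟩, C, envelope_abs_le hS hbound (LipB.le_UCB hu) hC t⟩

/-- A list that is nearly optimal for the limit is fixed, and the composition along it is continuous
from below. -/
theorem envelope_increasesTo (hS : IsLinearFellerFamily κ S) (hbound : HasUniformBounds κ S)
    {u : ℕ → M → ℝ} {w : M → ℝ} (hu : ∀ n, u n ∈ UCB κ) (hw : w ∈ UCB κ) (huw : IncreasesTo u w)
    (t : ℝ≥0) : IncreasesTo (fun n => envelope S t (u n)) (envelope S t w) := by
  have hle : ∀ n x, u n x ≤ w x := fun n x =>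
    (monotone_nat_of_le_succ fun n => huw.1 n x).ge_of_tendsto (huw.2 x) n
  refine ⟨fun n => envelope_mono hS hbound (hu n) (hu (n + 1)) (huw.1 n) t, fun x =>
    tendsto_order.2 ⟨fun a ha => ?_, fun a ha => Eventually.of_forall fun n =>
      (envelope_mono hS hbound (hu n) hw (hle n) t x).trans_lt ha⟩⟩
  rw [envelope_eq_iSup hS hbound hw] at ha
  obtain ⟨h, hh⟩ := exists_lt_of_lt_ciSup ha
  filter_upwards [(tendsto_order.1 ((incOp_increasesTo hS hbound hu hw huw h).2 x)).1 a hh] with n hn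
  exact hn.trans_le (incOp_le_envelope hS hbound (hu n) h.2 x)

/-- On a separable space the envelope of a function in `Lip_b` is attained along an increasing
sequence of compositions. -/
theorem exists_incOp_increasesTo_envelope [TopologicalSpace.SeparableSpace M]
    (hS : IsLinearFellerFamily κ S) (hbound : HasUniformBounds κ S) (hu : u ∈ LipB M) (t : ℝ≥0) :
    ∃ h : ℕ → List ℝ≥0, (∀ n, (h n).sum = t) ∧
      IncreasesTo (fun n => incOp S (h n) u) (envelope S t u) := by
  have hu' := LipB.le_UCB (κ := κ) hu
  cases isEmpty_or_nonempty M with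
  | inl hM => exact ⟨fun _ => [t], by simp, fun _ x => isEmptyElim x, fun x => isEmptyElim x⟩
  | inr hM =>
  obtain ⟨L, hL, hL'⟩ := envelope_lipschitzWith hS hbound hu t
  let F : {h : List ℝ≥0 // h.sum = t} → M → ℝ := fun h => incOp S h u
  have hdir : ∀ h k, ∃ m, F h ≤ F m ∧ F k ≤ F m := fun h k => by
    obtain ⟨m, hm, h1, h2⟩ := exists_incOp_refinement hS hbound hu' _ h.1 k.1 le_rfl
      (h.2.trans k.2.symm)
    exact ⟨⟨m, hm.trans h.2⟩, h1, h2⟩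
  choose J hJ₁ hJ₂ using hdir
  have hex : ∀ p : ℕ × ℕ, ∃ h : {h : List ℝ≥0 // h.sum = t},
      envelope S t u (TopologicalSpace.denseSeq M p.1) - 1 / (p.2 + 1 : ℝ) <
        F h (TopologicalSpace.denseSeq M p.1) := fun p => by
    apply exists_lt_of_lt_ciSup
    rw [← envelope_eq_iSup hS hbound hu']
    exact sub_lt_self _ (by positivity)
  choose G hG using hex
  -- Starting from `G (0, 0)`, each step takes a common refinement with the next `G (k, m)`, a list
  -- that is optimal up to `1 / (m + 1)` at the `k`-th dense point. `Nat.unpair` runs through all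
  -- these pairs.
  let H : ℕ → {h : List ℝ≥0 // h.sum = t} := fun n =>
    Nat.rec (G (0, 0)) (fun n h => J h (G n.unpair)) n
  have hmono : Monotone fun n => F (H n) := monotone_nat_of_le_succ fun n => hJ₁ _ _
  refine ⟨fun n => (H n).1, fun n => (H n).2, fun n x => hmono n.le_succ x, fun x => ?_⟩
  refine tendsto_order.2 ⟨fun a ha => ?_, fun a ha => Eventually.of_forall fun n =>
    (incOp_le_envelope hS hbound hu' (H n).2 x).trans_lt ha⟩
  -- The gap is cut in three: moving the envelope to a dense point, the near-optimality there, and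
  -- moving the composition back.
  set ε := (envelope S t u x - a) / 3
  have hε : 0 < ε := by simp only [ε]; linarith
  obtain ⟨k, hk⟩ := (TopologicalSpace.denseRange_denseSeq M).exists_dist_lt x
    (show 0 < ε / (L + 1) by positivity)
  obtain ⟨m, hm⟩ := exists_nat_one_div_lt hε
  have hd : (L : ℝ) * dist x (TopologicalSpace.denseSeq M k) ≤ ε := by
    rw [lt_div_iff₀ (by positivity)] at hk
    nlinarith [dist_nonneg (x := x) (y := TopologicalSpace.denseSeq M k)]
  have h1 := hG (k, m)
  filter_upwards [eventually_ge_atTop (Nat.pair k m + 1)] with n hn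
  have h2 : F (G (k, m)) ≤ F (H n) := by
    refine le_trans ?_ (hmono hn)
    have h0 : H (Nat.pair k m + 1) = J (H (Nat.pair k m)) (G (k, m)) := by
      change J (H (Nat.pair k m)) (G (Nat.pair k m).unpair) = _
      rw [Nat.unpair_pair]
    simp only [h0]
    exact hJ₂ _ _
  have h3 := h2 (TopologicalSpace.denseSeq M k)
  have h4 := (hL.dist_le_mul x (TopologicalSpace.denseSeq M k)).trans hd
  have h5 := ((hL' (H n).1 (H n).2).dist_le_mul x (TopologicalSpace.denseSeq M k)).trans hd
  rw [Real.dist_eq] at h4 h5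
  have h6 := (abs_le.1 h4).2
  have h7 := (abs_le.1 h5).1
  simp only at h1
  change a < F (H n) x
  change -ε ≤ F (H n) x - F (H n) _ at h7
  have h8 : envelope S t u x - a = 3 * ε := by simp only [ε]; ring
  linarith

/-- The semigroup property of the envelope on `Lip_b`. -/
theorem envelope_add_time [TopologicalSpace.SeparableSpace M] (hS : IsLinearFellerFamily κ S)
    (hbound : HasUniformBounds κ S) (hu : u ∈ LipB M) (s t : ℝ≥0) :
    envelope S (s + t) u = envelope S s (envelope S t u) := by
  have hu' := LipB.le_UCB (κ := κ) hu
  have he := LipB.le_UCB (κ := κ) (envelope_mem_lipB hS hbound hu t)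
  funext x
  refine le_antisymm (envelope_le hS hbound hu' fun h hh => ?_) (envelope_le hS hbound he fun h hh => ?_)
  · obtain ⟨h₁, h₂, hs, ht, hle⟩ := exists_incOp_split hS hbound hu' h s t hh
    exact (hle x).trans ((incOp_mono hS hbound (incOp_mem_UCB hS hbound hu' h₂) he
      (incOp_le_envelope hS hbound hu' ht) h₁ x).trans (incOp_le_envelope hS hbound he hs x))
  -- Continuity from below is sequential and cannot be applied to the supremum over all lists; the
  -- increasing sequence of compositions makes it applicable.
  · obtain ⟨k, hk, hlim⟩ := exists_incOp_increasesTo_envelope hS hbound hu t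
    refine le_of_tendsto' ((incOp_increasesTo hS hbound
      (fun n => incOp_mem_UCB hS hbound hu' (k n)) he hlim h).2 x) fun n => ?_
    change incOp S h (incOp S (k n) u) x ≤ _
    rw [← incOp_append]
    exact incOp_le_envelope hS hbound hu' (by rw [List.sum_append, hh, hk]) x

end Envelope

/-! ### Extension of the envelope to bounded continuous functions -/

/-- A sublinear Markovian semigroup on bounded continuous functions that is continuous from
above. -/
structure IsSublinearSemigroup {M : Type*} [TopologicalSpace M]
    (T : ℝ≥0 → (M → ℝ) → M → ℝ) : Prop where
  bc : ∀ {u : M → ℝ}, BC u → ∀ t, BC (T t u)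
  mono : ∀ {u v : M → ℝ}, BC u → BC v → (∀ x, u x ≤ v x) → ∀ t x, T t u x ≤ T t v x
  add_le : ∀ {u v : M → ℝ}, BC u → BC v → ∀ t x, T t (fun y => u y + v y) x ≤ T t u x + T t v x
  smul_le : ∀ {u : M → ℝ}, BC u → ∀ {r : ℝ}, 0 ≤ r → ∀ t x, T t (fun y => r * u y) x ≤ r * T t u x
  const : ∀ (c : ℝ) t x, T t (fun _ => c) x = c
  zero : ∀ {u : M → ℝ}, BC u → T 0 u = u
  time_add : ∀ {u : M → ℝ}, BC u → ∀ s t, T (s + t) u = T s (T t u)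
  from_above : ∀ {u : ℕ → M → ℝ} {w : M → ℝ}, (∀ n, BC (u n)) → BC w → DecreasesTo u w →
    ∀ t, DecreasesTo (fun n => T t (u n)) (T t w)

/-- The extension of the envelope to bounded continuous functions: the infimum of the envelopes of
the dominating functions in `Lip_b`. -/
def extOp {M Λ : Type*} [MetricSpace M] {κ : Weight M}
    (S : Λ → ℝ≥0 → UC κ →ₗ[ℝ] UC κ) (t : ℝ≥0) (u : M → ℝ) : M → ℝ := fun x =>
  ⨅ w : {w : M → ℝ // w ∈ LipB M ∧ ∀ y, u y ≤ w y}, envelope S t w x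

section ExtOp

theorem DecreasesTo.le {M : Type*} {u : ℕ → M → ℝ} {w : M → ℝ} (h : DecreasesTo u w) (n : ℕ)
    (x : M) : w x ≤ u n x :=
  (antitone_nat_of_succ_le fun n => h.1 n x).le_of_tendsto (h.2 x) n

theorem IncreasesTo.le {M : Type*} {u : ℕ → M → ℝ} {w : M → ℝ} (h : IncreasesTo u w) (n : ℕ)
    (x : M) : u n x ≤ w x :=
  (monotone_nat_of_le_succ fun n => h.1 n x).ge_of_tendsto (h.2 x) n

variable {M Λ : Type*} [MetricSpace M] [Nonempty Λ] {κ : Weight M}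
  {S : Λ → ℝ≥0 → UC κ →ₗ[ℝ] UC κ} {u v : M → ℝ} {C : ℝ}

theorem extOp_le (hS : IsLinearFellerFamily κ S) (hbound : HasUniformBounds κ S)
    (hu : BC u) {w : M → ℝ} (hw : w ∈ LipB M) (huw : ∀ x, u x ≤ w x) (t : ℝ≥0) (x : M) :
    extOp S t u x ≤ envelope S t w x := by
  obtain ⟨C, hC⟩ := hu.2
  refine ciInf_le (f := fun w : {w : M → ℝ // w ∈ LipB M ∧ ∀ y, u y ≤ w y} => envelope S t w x)
    ⟨-C, ?_⟩ ⟨w, hw, huw⟩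
  rintro _ ⟨⟨w, hw, huw⟩, rfl⟩
  have hc : (fun _ : M => -C) ∈ UCB κ := LipB.le_UCB (LipB.const_mem (-C))
  have h1 := envelope_abs_le (C := C) hS hbound hc
    (fun y => by rw [abs_neg, abs_of_nonneg ((abs_nonneg _).trans (hC x))]) t x
  exact (abs_le.1 h1).1.trans (envelope_mono hS hbound hc (LipB.le_UCB hw)
    (fun y => (abs_le.1 (hC y)).1.trans (huw y)) t x)

omit [Nonempty Λ] in
theorem le_extOp (hu : BC u) {t : ℝ≥0} {x : M} {r : ℝ}
    (H : ∀ w ∈ LipB M, (∀ y, u y ≤ w y) → r ≤ envelope S t w x) : r ≤ extOp S t u x := by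
  obtain ⟨C, hC⟩ := hu.2
  have : Nonempty {w : M → ℝ // w ∈ LipB M ∧ ∀ y, u y ≤ w y} :=
    ⟨⟨fun _ => C, LipB.const_mem C, fun y => (abs_le.1 (hC y)).2⟩⟩
  exact le_ciInf fun w => H w w.2.1 w.2.2

theorem extOp_of_mem_lipB (hS : IsLinearFellerFamily κ S) (hbound : HasUniformBounds κ S)
    (hu : u ∈ LipB M) (t : ℝ≥0) : extOp S t u = envelope S t u := by
  funext x
  refine le_antisymm (extOp_le hS hbound (BC.of_lipB hu) hu (fun _ => le_rfl) t x)
    (le_extOp (BC.of_lipB hu) fun w hw huw => ?_)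
  exact envelope_mono hS hbound (LipB.le_UCB hu) (LipB.le_UCB hw) huw t x

theorem extOp_mono (hS : IsLinearFellerFamily κ S) (hbound : HasUniformBounds κ S)
    (hu : BC u) (hv : BC v) (huv : ∀ x, u x ≤ v x) (t : ℝ≥0) (x : M) :
    extOp S t u x ≤ extOp S t v x :=
  le_extOp hv fun _ hw hvw => extOp_le hS hbound hu hw (fun y => (huv y).trans (hvw y)) t x

/-- The values of the envelope along a sandwich in `Lip_b` merge. -/
theorem tendsto_envelope_sandwich (hS : IsLinearFellerFamily κ S) (hbound : HasUniformBounds κ S)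
    (habove : ContinuousFromAboveOn (envelope S) (LipB M)) {a b : ℕ → M → ℝ}
    (ha : ∀ n, a n ∈ LipB M) (hb : ∀ n, b n ∈ LipB M) (hau : IncreasesTo a u)
    (hbu : DecreasesTo b u) (t : ℝ≥0) (x : M) :
    Tendsto (fun n => envelope S t (b n) x - envelope S t (a n) x) atTop (𝓝 0) := by
  have h1 : DecreasesTo (fun n => b n - a n) 0 :=
    ⟨fun n y => sub_le_sub (hbu.1 n y) (hau.1 n y), fun y => by
      simpa using (hbu.2 y).sub (hau.2 y)⟩
  have h2 := (habove t _ (fun n => sub_mem (hb n) (ha n)) h1).2 x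
  refine tendsto_of_tendsto_of_tendsto_of_le_of_le tendsto_const_nhds h2 (fun n => ?_) fun n => ?_
  · exact sub_nonneg.2 (envelope_mono hS hbound (LipB.le_UCB (ha n)) (LipB.le_UCB (hb n))
      (fun y => (hau.le n y).trans (hbu.le n y)) t x)
  · have := envelope_add_le hS hbound (LipB.le_UCB (sub_mem (hb n) (ha n))) (LipB.le_UCB (ha n)) t x
    rw [sub_add_cancel] at this
    simp only
    linarith

theorem envelope_le_extOp (hS : IsLinearFellerFamily κ S) (hbound : HasUniformBounds κ S)
    (hu : BC u) {w : M → ℝ} (hw : w ∈ LipB M) (huw : ∀ x, w x ≤ u x) (t : ℝ≥0) (x : M) :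
    envelope S t w x ≤ extOp S t u x :=
  le_extOp hu fun _ hw' huw' => envelope_mono hS hbound (LipB.le_UCB hw) (LipB.le_UCB hw')
    (fun y => (huw y).trans (huw' y)) t x

/-- The extension lies between the values along any lower and any upper approximation, and these
merge. Hence every decreasing sequence in `Lip_b` with limit `u` computes the infimum in `extOp`. -/
theorem tendsto_envelope_of_decreasesTo (hS : IsLinearFellerFamily κ S)
    (hbound : HasUniformBounds κ S) (habove : ContinuousFromAboveOn (envelope S) (LipB M))
    (hu : BC u) {b : ℕ → M → ℝ} (hb : ∀ n, b n ∈ LipB M) (hbu : DecreasesTo b u) (t : ℝ≥0) (x : M) :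
    Tendsto (fun n => envelope S t (b n) x) atTop (𝓝 (extOp S t u x)) := by
  obtain ⟨a, ha, hau, -⟩ := exists_lipB_increasesTo hu
  have h := tendsto_envelope_sandwich hS hbound habove ha hb hau hbu t x
  refine tendsto_of_tendsto_of_tendsto_of_le_of_le tendsto_const_nhds
    (by simpa using h.add_const (extOp S t u x))
    (fun n => extOp_le hS hbound hu (hb n) (hbu.le n) t x) fun n => ?_
  have := envelope_le_extOp hS hbound hu (ha n) (hau.le n) t x
  simp only
  linarith

theorem tendsto_envelope_of_increasesTo (hS : IsLinearFellerFamily κ S)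
    (hbound : HasUniformBounds κ S) (habove : ContinuousFromAboveOn (envelope S) (LipB M))
    (hu : BC u) {a : ℕ → M → ℝ} (ha : ∀ n, a n ∈ LipB M) (hau : IncreasesTo a u) (t : ℝ≥0) (x : M) :
    Tendsto (fun n => envelope S t (a n) x) atTop (𝓝 (extOp S t u x)) := by
  obtain ⟨b, hb, hbu, -⟩ := exists_lipB_decreasesTo hu
  have h := tendsto_envelope_sandwich hS hbound habove ha hb hau hbu t x
  refine tendsto_of_tendsto_of_tendsto_of_le_of_le
    (by simpa using h.const_sub (extOp S t u x)) tendsto_const_nhds (fun n => ?_)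
    (fun n => envelope_le_extOp hS hbound hu (ha n) (hau.le n) t x)
  have := extOp_le hS hbound hu (hb n) (hbu.le n) t x
  simp only
  linarith

/-- Along `a_n ↗ u` in `Lip_b`, the values converge to the extension by the sandwich and to the
envelope by continuity from below. -/
theorem extOp_of_mem_UC (hS : IsLinearFellerFamily κ S)
    (hbound : HasUniformBounds κ S) (habove : ContinuousFromAboveOn (envelope S) (LipB M))
    (hu : BC u) (hu' : u ∈ UC κ) (t : ℝ≥0) : extOp S t u = envelope S t u := by
  funext x
  obtain ⟨a, ha, hau, -⟩ := exists_lipB_increasesTo hu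
  exact tendsto_nhds_unique (tendsto_envelope_of_increasesTo hS hbound habove hu ha hau t x)
    ((envelope_increasesTo hS hbound (fun n => LipB.le_UCB (ha n)) ⟨hu', hu.2⟩ hau t).2 x)

/-- The extension is lower semicontinuous as a supremum of the continuous `𝒮(t)a_n` and upper
semicontinuous as an infimum of the `𝒮(t)b_n`. -/
theorem extOp_bc (hS : IsLinearFellerFamily κ S)
    (hbound : HasUniformBounds κ S) (habove : ContinuousFromAboveOn (envelope S) (LipB M))
    (hu : BC u) (t : ℝ≥0) : BC (extOp S t u) := by
  obtain ⟨C, hC⟩ := hu.2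
  obtain ⟨a, ha, hau, -⟩ := exists_lipB_increasesTo hu
  obtain ⟨b, hb, hbu, -⟩ := exists_lipB_decreasesTo hu
  refine ⟨continuous_iff_continuousAt.2 fun x => tendsto_order.2 ⟨fun r hr => ?_, fun r hr => ?_⟩,
    C, fun x => abs_le.2 ⟨le_extOp hu fun w hw huw => ?_, ?_⟩⟩
  · obtain ⟨n, hn⟩ := ((tendsto_order.1 (tendsto_envelope_of_increasesTo hS hbound habove hu ha hau
      t x)).1 r hr).exists
    have hc := (envelope_mem_lipB hS hbound (ha n) t).1.choose_spec.continuous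
    filter_upwards [hc.continuousAt.eventually_const_lt hn] with y hy
    exact hy.trans_le (envelope_le_extOp hS hbound hu (ha n) (hau.le n) t y)
  · obtain ⟨n, hn⟩ := ((tendsto_order.1 (tendsto_envelope_of_decreasesTo hS hbound habove hu hb hbu
      t x)).2 r hr).exists
    have hc := (envelope_mem_lipB hS hbound (hb n) t).1.choose_spec.continuous
    filter_upwards [hc.continuousAt.eventually_lt_const hn] with y hy
    exact (extOp_le hS hbound hu (hb n) (hbu.le n) t y).trans_lt hy
  · have hc : (fun _ : M => -C) ∈ UCB κ := LipB.le_UCB (LipB.const_mem (-C))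
    have h1 := envelope_abs_le (C := C) hS hbound hc
      (fun y => by rw [abs_neg, abs_of_nonneg ((abs_nonneg _).trans (hC x))]) t x
    exact (abs_le.1 h1).1.trans (envelope_mono hS hbound hc (LipB.le_UCB hw)
      (fun y => (abs_le.1 (hC y)).1.trans (huw y)) t x)
  · have hc : (fun _ : M => C) ∈ LipB M := LipB.const_mem C
    exact (extOp_le hS hbound hu hc (fun y => (abs_le.1 (hC y)).2) t x).trans
      (abs_le.1 (envelope_abs_le (C := C) hS hbound (LipB.le_UCB hc)
        (fun y => (abs_of_nonneg ((abs_nonneg _).trans (hC x))).le) t x)).2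

/-- A diagonal sequence in `Lip_b` dominates `u n` and still decreases to `w`; its envelopes tend to
the extension at `w` and squeeze those of `u n`. -/
theorem extOp_from_above (hS : IsLinearFellerFamily κ S)
    (hbound : HasUniformBounds κ S) (habove : ContinuousFromAboveOn (envelope S) (LipB M))
    {u : ℕ → M → ℝ} {w : M → ℝ} (hu : ∀ n, BC (u n)) (hw : BC w) (huw : DecreasesTo u w) (t : ℝ≥0) :
    DecreasesTo (fun n => extOp S t (u n)) (extOp S t w) := by
  obtain ⟨b, hb, hbw, hub⟩ := exists_lipB_decreasesTo_diagonal hu huw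
  refine ⟨fun n => extOp_mono hS hbound (hu _) (hu n) (huw.1 n) t, fun x => ?_⟩
  exact tendsto_of_tendsto_of_tendsto_of_le_of_le tendsto_const_nhds
    (tendsto_envelope_of_decreasesTo hS hbound habove hw hb hbw t x)
    (fun n => extOp_mono hS hbound hw (hu n) (huw.le n) t x)
    fun n => extOp_le hS hbound (hu n) (hb n) (hub n) t x

theorem isSublinearSemigroup_extOp [TopologicalSpace.SeparableSpace M]
    (hS : IsLinearFellerFamily κ S) (hbound : HasUniformBounds κ S)
    (habove : ContinuousFromAboveOn (envelope S) (LipB M)) : IsSublinearSemigroup (extOp S) where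
  bc hu t := extOp_bc hS hbound habove hu t
  mono hu hv huv t x := extOp_mono hS hbound hu hv huv t x
  add_le := by
    intro u v hu hv t x
    obtain ⟨a, ha, hau, -⟩ := exists_lipB_decreasesTo hu
    obtain ⟨b, hb, hbv, -⟩ := exists_lipB_decreasesTo hv
    refine ge_of_tendsto' ((tendsto_envelope_of_decreasesTo hS hbound habove hu ha hau t x).add
      (tendsto_envelope_of_decreasesTo hS hbound habove hv hb hbv t x)) fun n => ?_
    exact (extOp_le hS hbound (hu.add hv) (add_mem (ha n) (hb n))
      (fun y => add_le_add (hau.le n y) (hbv.le n y)) t x).trans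
      (envelope_add_le hS hbound (LipB.le_UCB (ha n)) (LipB.le_UCB (hb n)) t x)
  smul_le := by
    intro u hu r hr t x
    obtain ⟨a, ha, hau, -⟩ := exists_lipB_decreasesTo hu
    refine ge_of_tendsto'
      ((tendsto_envelope_of_decreasesTo hS hbound habove hu ha hau t x).const_mul r) fun n => ?_
    exact (extOp_le hS hbound (hu.const_mul r) (Submodule.smul_mem _ r (ha n))
      (fun y => mul_le_mul_of_nonneg_left (hau.le n y) hr) t x).trans
      (envelope_smul_le hS hbound (LipB.le_UCB (ha n)) hr t x)
  const c t x := by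
    rw [extOp_of_mem_lipB hS hbound (LipB.const_mem c), envelope_const hS hbound]
  zero := by
    intro u hu
    funext x
    obtain ⟨a, ha, hau, -⟩ := exists_lipB_decreasesTo hu
    have h := tendsto_envelope_of_decreasesTo hS hbound habove hu ha hau 0 x
    simp only [envelope_zero hS hbound (LipB.le_UCB (ha _))] at h
    exact tendsto_nhds_unique h (hau.2 x)
  -- The identity holds on `Lip_b`. To pass to the limit on the right, continuity from above is used
  -- twice, the second time along `T(t)a_n`, which decreases to `T(t)u`.
  time_add := by
    intro u hu s t
    funext x
    obtain ⟨a, ha, hau, -⟩ := exists_lipB_decreasesTo hu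
    have h1 := (extOp_from_above hS hbound habove (fun n => BC.of_lipB (ha n)) hu hau (s + t)).2 x
    have h2 := extOp_from_above hS hbound habove (fun n => BC.of_lipB (ha n)) hu hau t
    have h3 := (extOp_from_above hS hbound habove
      (fun n => extOp_bc hS hbound habove (BC.of_lipB (ha n)) t)
      (extOp_bc hS hbound habove hu t) h2 s).2 x
    refine tendsto_nhds_unique h1 (h3.congr fun n => ?_)
    change extOp S s (extOp S t (a n)) x = extOp S (s + t) (a n) x
    rw [extOp_of_mem_lipB hS hbound (ha n), extOp_of_mem_lipB hS hbound (ha n),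
      extOp_of_mem_lipB hS hbound (envelope_mem_lipB hS hbound (ha n) t),
      envelope_add_time hS hbound (ha n)]
  from_above hu hw huw t := extOp_from_above hS hbound habove hu hw huw t

end ExtOp

/-! ### Sublinear conditional expectations on path space -/

section Joint

variable {M : Type*} [TopologicalSpace M] {T : ℝ≥0 → (M → ℝ) → M → ℝ}

theorem IsSublinearSemigroup.abs_sub_le (hT : IsSublinearSemigroup T) {u v g : M → ℝ} (hu : BC u)
    (hv : BC v) (hg : BC g) (h : ∀ x, |u x - v x| ≤ g x) (t : ℝ≥0) (x : M) :
    |T t u x - T t v x| ≤ T t g x := by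
  have key : ∀ {u v : M → ℝ}, BC u → BC v → (∀ x, |u x - v x| ≤ g x) →
      T t u x - T t v x ≤ T t g x := by
    intro u v hu hv h
    have h1 := hT.mono hu (hv.add hg) (fun y => by linarith [(abs_le.1 (h y)).2]) t x
    linarith [hT.add_le hv hg t x]
  refine abs_le.2 ⟨?_, key hu hv h⟩
  have := key hv hu (fun y => by rw [abs_sub_comm]; exact h y)
  linarith

/-- Joint continuity of `(y, x) ↦ (T(t) v(y, ·))(x)`. -/
theorem IsSublinearSemigroup.continuous_joint (hT : IsSublinearSemigroup T) {Y : Type*}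
    [TopologicalSpace Y] [SequentialSpace (Y × M)] {v : Y × M → ℝ} (hv : BC v) (t : ℝ≥0) :
    Continuous fun p : Y × M => T t (fun z => v (p.1, z)) p.2 := by
  rw [continuous_iff_seqContinuous]
  rintro p ⟨y, x⟩ hp
  have hy : Tendsto (fun k => (p k).1) atTop (𝓝 y) := (continuous_fst.tendsto _).comp hp
  have hx : Tendsto (fun k => (p k).2) atTop (𝓝 x) := (continuous_snd.tendsto _).comp hp
  have hsec : ∀ y, BC fun z => v (y, z) := fun y => hv.comp (by fun_prop)
  obtain ⟨C, hC⟩ := hv.2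
  -- A tail of the sequence together with its limit is compact. Hence `g k`, the largest deviation
  -- of `v(y', ·)` from `v(y, ·)` over `y' ∈ K k`, is continuous, and it decreases to `0` pointwise.
  let K : ℕ → Set Y := fun k => insert y (Set.range fun j => (p (j + k)).1)
  have hK : ∀ k, IsCompact (K k) := fun k =>
    Tendsto.isCompact_insert_range ((tendsto_add_atTop_iff_nat k).2 hy)
  let φ : M → Y → ℝ := fun z y' => |v (y', z) - v (y, z)|
  have hφC : ∀ z y', φ z y' ≤ 2 * C := fun z y' => by
    have h1 := abs_le.1 (hC (y', z))
    have h2 := abs_le.1 (hC (y, z))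
    exact abs_le.2 ⟨by linarith, by linarith⟩
  have hφ : Continuous ↿φ := by
    have := hv.1
    change Continuous fun q : M × Y => |v (q.2, q.1) - v (y, q.1)|
    fun_prop
  let g : ℕ → M → ℝ := fun k z => sSup (φ z '' K k)
  have hne : ∀ k z, (φ z '' K k).Nonempty := fun k z => ⟨_, y, Set.mem_insert _ _, rfl⟩
  have hbdd : ∀ k z, BddAbove (φ z '' K k) := fun k z =>
    ⟨2 * C, by rintro _ ⟨y', -, rfl⟩; exact hφC z y'⟩
  have hle : ∀ k z, ∀ y' ∈ K k, φ z y' ≤ g k z := fun k z y' hy' =>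
    le_csSup (hbdd k z) ⟨y', hy', rfl⟩
  have hg0 : ∀ k z, 0 ≤ g k z := fun k z => (abs_nonneg _).trans (hle k z y (Set.mem_insert _ _))
  have hg : ∀ k, BC (g k) := fun k => ⟨(hK k).continuous_sSup hφ, 2 * C, fun z => by
    rw [abs_of_nonneg (hg0 k z)]
    exact csSup_le (hne k z) (by rintro _ ⟨y', -, rfl⟩; exact hφC z y')⟩
  have hKanti : ∀ k, K (k + 1) ⊆ K k := by
    rintro k _ (rfl | ⟨j, rfl⟩)
    · exact Set.mem_insert _ _
    · exact Set.mem_insert_of_mem _ ⟨j + 1, by simp only; congr 2; ring⟩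
  have hgdec : DecreasesTo g (fun _ => 0) := by
    refine ⟨fun k z => csSup_le_csSup (hbdd k z) (hne _ z) (Set.image_mono (hKanti k)), fun z => ?_⟩
    refine tendsto_order.2 ⟨fun r hr => Eventually.of_forall fun k => hr.trans_le (hg0 k z),
      fun r hr => ?_⟩
    have hlim : Tendsto (fun k => φ z (p k).1) atTop (𝓝 0) := by
      have h1 : Tendsto (fun k => v ((p k).1, z)) atTop (𝓝 (v (y, z))) :=
        (hv.1.tendsto _).comp (hy.prodMk_nhds tendsto_const_nhds)
      simpa using (h1.sub_const (v (y, z))).abs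
    obtain ⟨N, hN⟩ := eventually_atTop.1 ((tendsto_order.1 hlim).2 (r / 2) (by linarith))
    filter_upwards [eventually_ge_atTop N] with k hk
    have h2 : g k z ≤ r / 2 := by
      refine csSup_le (hne k z) ?_
      rintro _ ⟨_, rfl | ⟨j, rfl⟩, rfl⟩
      · simp only [φ, sub_self, abs_zero]; linarith
      · exact (hN (j + k) (by omega)).le
    linarith
  have hTg := hT.from_above hg (BC.const 0) hgdec t
  have hTg_anti : ∀ z, Antitone fun k => T t (g k) z := fun z =>
    antitone_nat_of_succ_le fun n => hTg.1 n z
  have hTg0 := hTg.2 x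
  rw [hT.const] at hTg0
  -- As in Dini's theorem: choose `m` with `T(t)(g m)` small at `x`, extend this to the nearby
  -- points by continuity, and pass to later `k` by monotonicity.
  have hmain : Tendsto (fun k => T t (g k) (p k).2) atTop (𝓝 0) := by
    refine tendsto_order.2 ⟨fun r hr => Eventually.of_forall fun k => hr.trans_le ?_, fun r hr => ?_⟩
    · have := hT.mono (BC.const 0) (hg k) (hg0 k) t (p k).2
      rwa [hT.const] at this
    · obtain ⟨m, hm⟩ := ((tendsto_order.1 hTg0).2 r hr).exists
      have hc := (((hT.bc (hg m) t).1.tendsto x).comp hx).eventually_lt_const hm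
      filter_upwards [hc, eventually_ge_atTop m] with k hk hkm
      exact (hTg_anti (p k).2 hkm).trans_lt hk
  have h0 : Tendsto (fun k => T t (fun z => v (y, z)) (p k).2) atTop (𝓝 (T t (fun z => v (y, z)) x)) :=
    ((hT.bc (hsec y) t).1.tendsto x).comp hx
  have hdiff : Tendsto (fun k => T t (fun z => v ((p k).1, z)) (p k).2 -
      T t (fun z => v (y, z)) (p k).2) atTop (𝓝 0) := by
    refine squeeze_zero_norm (fun k => ?_) hmain
    refine hT.abs_sub_le (hsec _) (hsec _) (hg k) (fun z => hle k z _ ?_) t _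
    exact Set.mem_insert_of_mem _ ⟨0, by simp⟩
  simpa [Function.comp_def] using hdiff.add h0

end Joint

/-! ### Cylinder functions and iterated conditional expectations -/

/-- Cylinder functions: bounded continuous functions of finitely many coordinates. -/
def IsCyl {M : Type*} [TopologicalSpace M] (f : (ℝ≥0 → M) → ℝ) : Prop :=
  BC f ∧ ∃ J : Finset ℝ≥0, DependsOn f (J : Set ℝ≥0)

/-- Extend a path on finitely many times by a constant. -/
def extendPath {M : Type*} (J : Finset ℝ≥0) (m₀ : M) (y : J → M) : ℝ≥0 → M :=
  fun r => if h : r ∈ J then y ⟨r, h⟩ else m₀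

theorem extendPath_apply {M : Type*} {J : Finset ℝ≥0} (m₀ : M) (y : J → M) {r : ℝ≥0} (h : r ∈ J) :
    extendPath J m₀ y r = y ⟨r, h⟩ := dif_pos h

theorem continuous_extendPath {M : Type*} [TopologicalSpace M] (J : Finset ℝ≥0) (m₀ : M) :
    Continuous (extendPath J m₀) := by
  refine continuous_pi fun r => ?_
  by_cases h : r ∈ J
  · simpa only [extendPath, h, dif_pos] using continuous_apply (⟨r, h⟩ : J)
  · simpa only [extendPath, h, dif_neg, not_false_iff] using continuous_const

/-- Integrate out the coordinate at time `t`, conditionally on the coordinate at time `s`. -/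
def stepOp {M : Type*} (T : ℝ≥0 → (M → ℝ) → M → ℝ) (s t : ℝ≥0) (f : (ℝ≥0 → M) → ℝ) :
    (ℝ≥0 → M) → ℝ :=
  fun ω => T (t - s) (fun z => f (Function.update ω t z)) (ω s)

/-- Integrate out successively all coordinates of the list but the first. -/
def pathOp {M : Type*} (T : ℝ≥0 → (M → ℝ) → M → ℝ) :
    List ℝ≥0 → ((ℝ≥0 → M) → ℝ) → (ℝ≥0 → M) → ℝ
  | a :: b :: l, f => stepOp T a b (pathOp T (b :: l) f)
  | _, f => f

section PathOp

variable {M : Type*} [TopologicalSpace M] {f g : (ℝ≥0 → M) → ℝ}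

theorem IsCyl.add (hf : IsCyl f) (hg : IsCyl g) : IsCyl (fun ω => f ω + g ω) := by
  obtain ⟨hf, J, hJ⟩ := hf
  obtain ⟨hg, K, hK⟩ := hg
  refine ⟨hf.add hg, J ∪ K, fun ω ω' h => ?_⟩
  simp only [Finset.coe_union] at h
  simp only [hJ fun i hi => h i (Or.inl hi), hK fun i hi => h i (Or.inr hi)]

theorem IsCyl.const_mul (hf : IsCyl f) (r : ℝ) : IsCyl (fun ω => r * f ω) :=
  ⟨hf.1.const_mul r, hf.2.imp fun _ hJ _ _ h => congrArg (r * ·) (hJ h)⟩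

theorem IsCyl.const (c : ℝ) : IsCyl (fun _ : ℝ≥0 → M => c) := ⟨BC.const c, ∅, fun _ _ _ => rfl⟩

theorem BC.update (hf : BC f) (ω : ℝ≥0 → M) (t : ℝ≥0) : BC fun z => f (Function.update ω t z) :=
  hf.comp (continuous_const.update t continuous_id)

omit [TopologicalSpace M] in
theorem update_eq_of_dependsOn {A : Set ℝ≥0} (hf : DependsOn f A) {r : ℝ≥0} (hr : r ∉ A)
    (ω : ℝ≥0 → M) (z : M) : f (Function.update ω r z) = f ω :=
  hf fun i hi => Function.update_of_ne (by rintro rfl; exact hr hi) _ _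

variable {T : ℝ≥0 → (M → ℝ) → M → ℝ}

omit [TopologicalSpace M] in
theorem stepOp_update (s t r : ℝ≥0) (hrs : r ≠ s)
    (hf : ∀ ω z, f (Function.update ω r z) = f ω) (ω : ℝ≥0 → M) (z : M) :
    stepOp T s t f (Function.update ω r z) = stepOp T s t f ω := by
  unfold stepOp
  rw [Function.update_of_ne hrs.symm]
  congr 1
  funext y
  rcases eq_or_ne r t with rfl | hrt
  · rw [Function.update_idem]
  · rw [Function.update_comm hrt, hf]

omit [TopologicalSpace M] in
theorem pathOp_update (r : ℝ≥0) (l : List ℝ≥0) (hr : r ∉ l)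
    (hf : ∀ ω z, f (Function.update ω r z) = f ω) (ω : ℝ≥0 → M) (z : M) :
    pathOp T l f (Function.update ω r z) = pathOp T l f ω := by
  induction l generalizing ω z with
  | nil => exact hf ω z
  | cons a l ih =>
    cases l with
    | nil => exact hf ω z
    | cons b l =>
      rw [List.mem_cons, not_or] at hr
      exact stepOp_update a b r hr.1 (ih hr.2) ω z

theorem stepOp_mono (hT : IsSublinearSemigroup T) (hf : BC f) (hg : BC g) (hfg : ∀ ω, f ω ≤ g ω)
    (s t : ℝ≥0) (ω : ℝ≥0 → M) : stepOp T s t f ω ≤ stepOp T s t g ω :=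
  hT.mono (hf.update ω t) (hg.update ω t) (fun _ => hfg _) _ _

variable [FirstCountableTopology M]

/-- The full path space need not be sequential, so `f` is factored through the finite power `J → M`,
where joint continuity can be checked along sequences. The filler `m₀` is irrelevant because `f`
depends on `J` only. -/
theorem stepOp_isCyl (hT : IsSublinearSemigroup T) (hf : IsCyl f) (s t : ℝ≥0) :
    IsCyl (stepOp T s t f) := by
  cases isEmpty_or_nonempty M with
  | inl hM =>
    have : IsEmpty (ℝ≥0 → M) := ⟨fun ω => isEmptyElim (ω 0)⟩
    exact ⟨⟨continuous_of_discreteTopology, 0, fun ω => isEmptyElim ω⟩, ∅, fun ω => isEmptyElim ω⟩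
  | inr hM =>
  classical
  obtain ⟨hf, J, hJ⟩ := hf
  let m₀ : M := Classical.arbitrary M
  let e : (J → M) → ℝ≥0 → M := extendPath J m₀
  have he : Continuous e := continuous_extendPath J m₀
  have heq : ∀ ω z, f (Function.update (e fun i => ω i) t z) = f (Function.update ω t z) := by
    intro ω z
    refine hJ fun i hi => ?_
    rcases eq_or_ne i t with rfl | hit
    · simp
    · rw [Function.update_of_ne hit, Function.update_of_ne hit]
      exact extendPath_apply m₀ _ hi
  have hv : BC fun p : (J → M) × M => f (Function.update (e p.1) t p.2) :=
    hf.comp ((he.comp continuous_fst).update t continuous_snd)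
  have hform : stepOp T s t f = fun ω =>
      T (t - s) (fun z => f (Function.update (e fun i : J => ω i) t z)) (ω s) := by
    funext ω
    simp only [heq]
    rfl
  refine ⟨⟨?_, ?_⟩, insert s J, fun ω ω' h => ?_⟩
  · rw [hform]
    exact (hT.continuous_joint hv (t - s)).comp
      (g := fun p : (J → M) × M => T (t - s) (fun z => f (Function.update (e p.1) t z)) p.2)
      (f := fun ω : ℝ≥0 → M => (fun i : J => ω i, ω s)) (by fun_prop)
  · obtain ⟨C, hC⟩ := hf.2
    refine ⟨C, fun ω => abs_le.2 ⟨?_, ?_⟩⟩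
    · have := hT.mono (BC.const (-C)) (hf.update ω t) (fun z => (abs_le.1 (hC _)).1) (t - s) (ω s)
      rwa [hT.const] at this
    · have := hT.mono (hf.update ω t) (BC.const C) (fun z => (abs_le.1 (hC _)).2) (t - s) (ω s)
      rwa [hT.const] at this
  · rw [hform]
    have h1 : (fun i : J => ω i) = fun i : J => ω' i := funext fun i => h i (by simp)
    simp only [h1, h s (by simp)]

theorem pathOp_isCyl (hT : IsSublinearSemigroup T) (hf : IsCyl f) (l : List ℝ≥0) :
    IsCyl (pathOp T l f) := by
  induction l with
  | nil => exact hf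
  | cons a l ih =>
    cases l with
    | nil => exact hf
    | cons b l => exact stepOp_isCyl hT ih a b

theorem pathOp_mono (hT : IsSublinearSemigroup T) (hf : IsCyl f) (hg : IsCyl g)
    (hfg : ∀ ω, f ω ≤ g ω) (l : List ℝ≥0) (ω : ℝ≥0 → M) : pathOp T l f ω ≤ pathOp T l g ω := by
  induction l generalizing ω with
  | nil => exact hfg ω
  | cons a l ih =>
    cases l with
    | nil => exact hfg ω
    | cons b l => exact stepOp_mono hT (pathOp_isCyl hT hf _).1 (pathOp_isCyl hT hg _).1 ih a b ω

theorem pathOp_add_le (hT : IsSublinearSemigroup T) (hf : IsCyl f) (hg : IsCyl g)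
    (l : List ℝ≥0) (ω : ℝ≥0 → M) :
    pathOp T l (fun ω => f ω + g ω) ω ≤ pathOp T l f ω + pathOp T l g ω := by
  induction l generalizing ω with
  | nil => exact le_rfl
  | cons a l ih =>
    cases l with
    | nil => exact le_rfl
    | cons b l =>
      have hf' := pathOp_isCyl hT hf (b :: l)
      have hg' := pathOp_isCyl hT hg (b :: l)
      exact (stepOp_mono hT (pathOp_isCyl hT (hf.add hg) _).1 (hf'.1.add hg'.1) ih a b ω).trans
        (hT.add_le (hf'.1.update ω b) (hg'.1.update ω b) _ _)

theorem pathOp_smul_le (hT : IsSublinearSemigroup T) (hf : IsCyl f) {r : ℝ} (hr : 0 ≤ r)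
    (l : List ℝ≥0) (ω : ℝ≥0 → M) : pathOp T l (fun ω => r * f ω) ω ≤ r * pathOp T l f ω := by
  induction l generalizing ω with
  | nil => exact le_rfl
  | cons a l ih =>
    cases l with
    | nil => exact le_rfl
    | cons b l =>
      have hf' := pathOp_isCyl hT hf (b :: l)
      exact (stepOp_mono hT (pathOp_isCyl hT (hf.const_mul r) _).1 (hf'.1.const_mul r) ih a b ω).trans
        (hT.smul_le (hf'.1.update ω b) hr _ _)

omit [FirstCountableTopology M] in
theorem pathOp_const (hT : IsSublinearSemigroup T) (c : ℝ) (l : List ℝ≥0) :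
    pathOp T l (fun _ => c) = fun _ => c := by
  induction l with
  | nil => rfl
  | cons a l ih =>
    cases l with
    | nil => rfl
    | cons b l =>
      funext ω
      rw [pathOp, ih]
      exact hT.const c _ _

theorem pathOp_from_above (hT : IsSublinearSemigroup T) {f : ℕ → (ℝ≥0 → M) → ℝ}
    (hf : ∀ n, IsCyl (f n)) (hg : IsCyl g) (hfg : DecreasesTo f g) (l : List ℝ≥0) :
    DecreasesTo (fun n => pathOp T l (f n)) (pathOp T l g) := by
  induction l with
  | nil => exact hfg
  | cons a l ih =>
    cases l with
    | nil => exact hfg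
    | cons b l =>
      have h : ∀ ω, DecreasesTo (fun n => T (b - a) fun z => pathOp T (b :: l) (f n)
          (Function.update ω b z)) (T (b - a) fun z => pathOp T (b :: l) g (Function.update ω b z)) :=
        fun ω => hT.from_above (fun n => (pathOp_isCyl hT (hf n) _).1.update ω b)
          ((pathOp_isCyl hT hg _).1.update ω b)
          ⟨fun n z => ih.1 n _, fun z => ih.2 _⟩ (b - a)
      exact ⟨fun n ω => (h ω).1 n (ω a), fun ω => (h ω).2 (ω a)⟩

/-- Chapman–Kolmogorov for the step operators. -/
theorem stepOp_pathOp_of_update (hT : IsSublinearSemigroup T) (hf : IsCyl f) {a b : ℝ≥0}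
    (hab : a ≤ b) (l : List ℝ≥0) (hl : (b :: l).Pairwise (· < ·))
    (hb : ∀ ω z, f (Function.update ω b z) = f ω) :
    stepOp T a b (pathOp T (b :: l) f) = pathOp T (a :: l) f := by
  cases l with
  | nil =>
    funext ω
    simp only [pathOp, stepOp, hb]
    exact hT.const _ _ _
  | cons c l =>
    have hbc : b < c := (List.pairwise_cons.1 hl).1 c (by simp)
    have hbl : b ∉ c :: l := fun h => lt_irrefl _ ((List.pairwise_cons.1 hl).1 b h)
    have hg := pathOp_update (T := T) b (c :: l) hbl hb
    funext ω
    change T (b - a) (fun y => T (c - b) (fun z => pathOp T (c :: l) f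
      (Function.update (Function.update ω b y) c z)) (Function.update ω b y b)) (ω a) =
      T (c - a) (fun z => pathOp T (c :: l) f (Function.update ω c z)) (ω a)
    -- Since `b` does not occur among the later times and `f` ignores it, overwriting the coordinate
    -- `b` has no effect on the inner function. What remains is `T(b - a)T(c - b) = T(c - a)`.
    simp only [Function.update_comm hbc.ne, hg, Function.update_self]
    rw [← tsub_add_tsub_cancel hbc.le hab, add_comm,
      hT.time_add ((pathOp_isCyl hT hf (c :: l)).1.update ω c)]

/-- Superfluous times are removed one by one with Chapman–Kolmogorov; the initial time `a` always
stays. -/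
theorem pathOp_eq_of_sublist (hT : IsSublinearSemigroup T) (hf : IsCyl f) {l₁ l₂ : List ℝ≥0}
    (hsub : l₁.Sublist l₂) (a : ℝ≥0) (hl : (a :: l₂).Pairwise (· < ·))
    (hr : ∀ r ∈ l₂, r ∉ l₁ → ∀ ω z, f (Function.update ω r z) = f ω) :
    pathOp T (a :: l₂) f = pathOp T (a :: l₁) f := by
  induction hsub generalizing a with
  | slnil => rfl
  | @cons l₁ l₂ b hsub ih =>
    have hl' := (List.pairwise_cons.1 hl).2
    have hbl : b ∉ l₂ := fun h => lt_irrefl _ ((List.pairwise_cons.1 hl').1 b h)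
    have hbl₁ : b ∉ l₁ := fun h => hbl (hsub.subset h)
    rw [pathOp, ih b hl' fun r h => hr r (List.mem_cons_of_mem _ h)]
    exact stepOp_pathOp_of_update hT hf ((List.pairwise_cons.1 hl).1 b (by simp)).le l₁
      (hl'.sublist (hsub.cons_cons b)) (hr b (by simp) hbl₁)
  | @cons_cons l₁ l₂ b hsub ih =>
    have hl' := (List.pairwise_cons.1 hl).2
    rw [pathOp, pathOp, ih b hl' fun r h h' => hr r (List.mem_cons_of_mem _ h) ?_]
    rw [List.mem_cons, not_or]
    refine ⟨?_, h'⟩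
    rintro rfl
    exact lt_irrefl _ ((List.pairwise_cons.1 hl').1 _ h)

-- Integration starts at the last time, so the final step can be absorbed into the integrand. The
-- Markov formula rests on this.
omit [TopologicalSpace M] [FirstCountableTopology M] in
theorem pathOp_append_pair (l : List ℝ≥0) (s t : ℝ≥0) (f : (ℝ≥0 → M) → ℝ) :
    pathOp T (l ++ [s, t]) f = pathOp T (l ++ [s]) (stepOp T s t f) := by
  induction l with
  | nil => rfl
  | cons a l ih =>
    cases l with
    | nil => rfl
    | cons b l => exact congrArg (stepOp T a b) ih

end PathOp

/-! ### Consistency of the finite-dimensional expectations -/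

/-- The finite-dimensional sublinear expectation along the times in `J`, started at `x`. -/
def finExp {M : Type*} (T : ℝ≥0 → (M → ℝ) → M → ℝ) (J : Finset ℝ≥0) (x : M)
    (f : (ℝ≥0 → M) → ℝ) : ℝ :=
  pathOp T (J.sort (· ≤ ·)) f fun _ => x

section FinExp

theorem exists_sort_eq_cons {J : Finset ℝ≥0} (hJ : 0 ∈ J) :
    ∃ l : List ℝ≥0, J.sort (· ≤ ·) = 0 :: l ∧ (0 :: l).Pairwise (· < ·) := by
  have hsort : (J.sort (· ≤ ·)).Pairwise (· < ·) := J.sortedLT_sort.pairwise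
  have h0 : (0 : ℝ≥0) ∈ J.sort (· ≤ ·) := (Finset.mem_sort _).2 hJ
  obtain ⟨a, l, hal⟩ := List.exists_cons_of_ne_nil (List.ne_nil_of_mem h0)
  rw [hal] at hsort h0
  have ha : a = 0 := by
    rcases List.mem_cons.1 h0 with h | h
    · exact h.symm
    · exact absurd ((List.pairwise_cons.1 hsort).1 0 h) not_lt_zero
  subst ha
  exact ⟨l, hal, hsort⟩

variable {M : Type*} [TopologicalSpace M] [FirstCountableTopology M] {f g : (ℝ≥0 → M) → ℝ}
  {T : ℝ≥0 → (M → ℝ) → M → ℝ}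

/-- This is Kolmogorov consistency. Requiring `0 ∈ J` makes both sorted lists begin at `0`, so the
removed times all lie in the tail. -/
theorem finExp_eq_of_subset (hT : IsSublinearSemigroup T) (hf : BC f) {J K : Finset ℝ≥0}
    (h0 : 0 ∈ J) (hJK : J ⊆ K) (hJ : DependsOn f (J : Set ℝ≥0)) (x : M) :
    finExp T K x f = finExp T J x f := by
  obtain ⟨l₁, h₁, hl₁⟩ := exists_sort_eq_cons h0
  obtain ⟨l₂, h₂, hl₂⟩ := exists_sort_eq_cons (hJK h0)
  have hmem₁ : ∀ b, b ∈ 0 :: l₁ ↔ b ∈ J := fun b => by rw [← h₁]; exact Finset.mem_sort _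
  have hmem₂ : ∀ b, b ∈ 0 :: l₂ ↔ b ∈ K := fun b => by rw [← h₂]; exact Finset.mem_sort _
  have hsub : (0 :: l₁).Sublist (0 :: l₂) := by
    refine List.sublist_of_subperm_of_pairwise (r := (· < ·)) ?_ hl₁ hl₂
    exact List.Nodup.subperm (hl₁.imp fun h => h.ne) fun b hb => (hmem₂ b).2 (hJK ((hmem₁ b).1 hb))
  unfold finExp
  rw [h₁, h₂, pathOp_eq_of_sublist hT ⟨hf, J, hJ⟩ (List.cons_sublist_cons.1 hsub) 0 hl₂]
  intro r hr hr'
  refine update_eq_of_dependsOn hJ fun h => ?_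
  rcases List.mem_cons.1 ((hmem₁ r).2 h) with rfl | h
  · exact lt_irrefl _ ((List.pairwise_cons.1 hl₂).1 _ hr)
  · exact hr' h

theorem finExp_eq (hT : IsSublinearSemigroup T) (hf : BC f) {J K : Finset ℝ≥0}
    (hJ0 : 0 ∈ J) (hK0 : 0 ∈ K) (hJ : DependsOn f (J : Set ℝ≥0)) (hK : DependsOn f (K : Set ℝ≥0))
    (x : M) : finExp T J x f = finExp T K x f := by
  classical
  rw [← finExp_eq_of_subset hT hf hJ0 Finset.subset_union_left hJ x,
    ← finExp_eq_of_subset hT hf hK0 Finset.subset_union_right hK x]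

/-- The sublinear expectation of a function of finitely many coordinates. -/
theorem finExp_step (hT : IsSublinearSemigroup T) (hf : BC f) {J K : Finset ℝ≥0} {s t : ℝ≥0}
    (hst : s < t) (hJ0 : 0 ∈ J) (hK0 : 0 ∈ K) (hJ : ∀ r ∈ J, r ≤ s) (hfJ : DependsOn f (insert t (J : Set ℝ≥0)))
    (hK : DependsOn f (K : Set ℝ≥0)) (hJ' : DependsOn (stepOp T s t f) (J : Set ℝ≥0)) (x : M) :
    finExp T J x (stepOp T s t f) = finExp T K x f := by
  classical
  have hfc : IsCyl f := ⟨hf, K, hK⟩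
  have hstep := stepOp_isCyl hT hfc s t
  -- Adjoining `s` makes it the last time before `t`, so that the step from `s` to `t` is the
  -- innermost one.
  set I := insert s J with hI
  have hI0 : 0 ∈ I := Finset.mem_insert_of_mem hJ0
  have hIs : ∀ r ∈ I, r ≤ s := fun r hr => by
    rcases Finset.mem_insert.1 hr with rfl | hr
    · exact le_rfl
    · exact hJ r hr
  have htI : DependsOn f ((insert t I : Finset ℝ≥0) : Set ℝ≥0) := by
    refine fun ω ω' h => hfJ fun i hi => h i ?_
    rcases hi with rfl | hi
    · simp
    · simp [hI, Finset.mem_coe.1 hi]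
  rw [← finExp_eq_of_subset hT hstep.1 hJ0 (Finset.subset_insert s J) hJ' x,
    finExp_eq hT hf hK0 (Finset.mem_insert_of_mem hI0) hK htI x]
  set l := (I.erase s).sort (· ≤ ·)
  have hlmem : ∀ r ∈ l, r < s := fun r hr => by
    have h := (Finset.mem_sort _).1 hr
    exact lt_of_le_of_ne (hIs r (Finset.mem_of_mem_erase h)) (Finset.ne_of_mem_erase h)
  have hl : l.Pairwise (· < ·) := (I.erase s).sortedLT_sort.pairwise
  have hsort : ∀ (A : Finset ℝ≥0) (k : List ℝ≥0), k.Pairwise (· < ·) → k.toFinset = A →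
      A.sort (· ≤ ·) = k := fun A k hk hA => by
    rw [← hA]
    exact (List.toFinset_sort (· ≤ ·) (hk.imp fun h => h.ne)).2 (hk.imp fun h => h.le)
  have h1 : I.sort (· ≤ ·) = l ++ [s] := by
    refine hsort _ _ (List.pairwise_append.2 ⟨hl, by simp, by simpa using hlmem⟩) ?_
    ext r
    simp only [List.mem_toFinset, List.mem_append, l, Finset.mem_sort, List.mem_singleton,
      Finset.mem_erase, hI, Finset.mem_insert]
    tauto
  have h2 : (insert t I).sort (· ≤ ·) = l ++ [s, t] := by
    refine hsort _ _ (List.pairwise_append.2 ⟨hl, by simpa using hst, fun r hr q hq => ?_⟩) ?_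
    · have := hlmem r hr
      simp only [List.mem_cons, List.not_mem_nil, or_false] at hq
      rcases hq with rfl | rfl
      · exact this
      · exact this.trans hst
    · ext r
      simp only [List.mem_toFinset, List.mem_append, l, Finset.mem_sort, List.mem_cons,
        Finset.mem_erase, hI, Finset.mem_insert, List.not_mem_nil, or_false]
      tauto
  unfold finExp
  rw [h1, h2, pathOp_append_pair]

end FinExp

/-! ### Linear functionals dominated by the path expectation -/

/-- The upper extension of the finite-dimensional expectations to all bounded continuous functions
on path space. -/
def pathExp {M : Type*} [TopologicalSpace M] (T : ℝ≥0 → (M → ℝ) → M → ℝ) (x : M)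
    (f : (ℝ≥0 → M) → ℝ) : ℝ :=
  sInf {r | ∃ (J : Finset ℝ≥0) (g : (ℝ≥0 → M) → ℝ), 0 ∈ J ∧ BC g ∧ DependsOn g (J : Set ℝ≥0) ∧
    (∀ ω, f ω ≤ g ω) ∧ r = finExp T J x g}

section PathExp

variable {M : Type*} [TopologicalSpace M] [FirstCountableTopology M] {f g : (ℝ≥0 → M) → ℝ}
  {T : ℝ≥0 → (M → ℝ) → M → ℝ} {J : Finset ℝ≥0}

theorem finExp_mono_of_dependsOn (hT : IsSublinearSemigroup T) {K : Finset ℝ≥0} (hf : BC f)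
    (hg : BC g) (hJ0 : 0 ∈ J) (hK0 : 0 ∈ K) (hJ : DependsOn f (J : Set ℝ≥0))
    (hK : DependsOn g (K : Set ℝ≥0)) (hfg : ∀ ω, f ω ≤ g ω) (x : M) :
    finExp T J x f ≤ finExp T K x g := by
  classical
  rw [← finExp_eq_of_subset hT hf hJ0 Finset.subset_union_left hJ x,
    ← finExp_eq_of_subset hT hg hK0 Finset.subset_union_right hK x]
  exact pathOp_mono hT ⟨hf, J, hJ⟩ ⟨hg, K, hK⟩ hfg _ _

theorem bddBelow_pathExp (hT : IsSublinearSemigroup T) (x : M) (hf : BC f) :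
    BddBelow {r | ∃ (J : Finset ℝ≥0) (g : (ℝ≥0 → M) → ℝ), 0 ∈ J ∧ BC g ∧
      DependsOn g (J : Set ℝ≥0) ∧ (∀ ω, f ω ≤ g ω) ∧ r = finExp T J x g} := by
  obtain ⟨C, hC⟩ := hf.2
  refine ⟨-C, ?_⟩
  rintro _ ⟨J, g, h0, hg, hJ, hfg, rfl⟩
  have h1 := finExp_mono_of_dependsOn hT (BC.const (-C)) hg h0 h0 (fun _ _ _ => rfl) hJ
    (fun ω => (abs_le.1 (hC ω)).1.trans (hfg ω)) x
  unfold finExp at h1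
  rwa [pathOp_const hT] at h1

theorem pathExp_le (hT : IsSublinearSemigroup T) (x : M) (hf : BC f) (h0 : 0 ∈ J) (hg : BC g)
    (hJ : DependsOn g (J : Set ℝ≥0)) (hfg : ∀ ω, f ω ≤ g ω) : pathExp T x f ≤ finExp T J x g :=
  csInf_le (bddBelow_pathExp hT x hf) ⟨J, g, h0, hg, hJ, hfg, rfl⟩

omit [FirstCountableTopology M] in
theorem le_pathExp (x : M) (hf : BC f) {r : ℝ}
    (H : ∀ (J : Finset ℝ≥0) (g : (ℝ≥0 → M) → ℝ), 0 ∈ J → BC g → DependsOn g (J : Set ℝ≥0) →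
      (∀ ω, f ω ≤ g ω) → r ≤ finExp T J x g) : r ≤ pathExp T x f := by
  obtain ⟨C, hC⟩ := hf.2
  refine le_csInf ⟨_, {0}, fun _ => C, by simp, BC.const C, fun _ _ _ => rfl,
    fun ω => (abs_le.1 (hC ω)).2, rfl⟩ ?_
  rintro _ ⟨J, g, h0, hg, hJ, hfg, rfl⟩
  exact H J g h0 hg hJ hfg

/-- The upper extension changes nothing on cylinder functions. It provides a sublinear functional on
the whole vector space of bounded continuous functions, as Hahn–Banach requires. -/
theorem pathExp_eq_finExp (hT : IsSublinearSemigroup T) (x : M) (hf : BC f) (h0 : 0 ∈ J)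
    (hJ : DependsOn f (J : Set ℝ≥0)) : pathExp T x f = finExp T J x f :=
  le_antisymm (pathExp_le hT x hf h0 hf hJ fun _ => le_rfl)
    (le_pathExp x hf fun _ _ h0' hg hK hfg =>
      finExp_mono_of_dependsOn hT hf hg h0 h0' hJ hK hfg x)

theorem pathExp_mono (hT : IsSublinearSemigroup T) (x : M) (hf : BC f) (hg : BC g)
    (hfg : ∀ ω, f ω ≤ g ω) : pathExp T x f ≤ pathExp T x g :=
  le_pathExp x hg fun _ _ h0 hh hK hgh =>
    pathExp_le hT x hf h0 hh hK fun ω => (hfg ω).trans (hgh ω)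

theorem pathExp_const (hT : IsSublinearSemigroup T) (x : M) (c : ℝ) :
    pathExp T x (fun _ => c) = c := by
  rw [pathExp_eq_finExp hT x (BC.const c) (J := {0}) (by simp) (fun _ _ _ => rfl), finExp,
    pathOp_const hT]

theorem pathExp_add_le (hT : IsSublinearSemigroup T) (x : M) (hf : BC f) (hg : BC g) :
    pathExp T x (fun ω => f ω + g ω) ≤ pathExp T x f + pathExp T x g := by
  classical
  rw [← sub_le_iff_le_add]
  refine le_pathExp x hf fun J f' hJ0 hf' hJ hff' => ?_
  rw [sub_le_comm]
  refine le_pathExp x hg fun K g' hK0 hg' hK hgg' => ?_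
  rw [sub_le_iff_le_add', ← finExp_eq_of_subset hT hf' hJ0 Finset.subset_union_left hJ x,
    ← finExp_eq_of_subset hT hg' hK0 Finset.subset_union_right hK x]
  refine (pathExp_le hT x (hf.add hg) (Finset.mem_union_left K hJ0) (hf'.add hg') ?_
    fun ω => add_le_add (hff' ω) (hgg' ω)).trans (pathOp_add_le hT ⟨hf', J, hJ⟩ ⟨hg', K, hK⟩ _ _)
  intro ω ω' h
  rw [Finset.coe_union] at h
  simp only [hJ fun i hi => h i (Or.inl hi), hK fun i hi => h i (Or.inr hi)]

theorem pathExp_smul_le (hT : IsSublinearSemigroup T) (x : M) (hf : BC f) {r : ℝ} (hr : 0 < r) :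
    pathExp T x (fun ω => r * f ω) ≤ r * pathExp T x f := by
  rw [mul_comm, ← div_le_iff₀ hr]
  refine le_pathExp x hf fun J g h0 hg hJ hfg => ?_
  rw [div_le_iff₀ hr, mul_comm]
  exact (pathExp_le hT x (hf.const_mul r) h0 (hg.const_mul r)
    (fun _ _ h => congrArg (r * ·) (hJ h)) fun ω => mul_le_mul_of_nonneg_left (hfg ω) hr.le).trans
    (pathOp_smul_le hT ⟨hg, J, hJ⟩ hr.le _ _)

theorem pathExp_smul (hT : IsSublinearSemigroup T) (x : M) (hf : BC f) {r : ℝ} (hr : 0 < r) :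
    pathExp T x (fun ω => r * f ω) = r * pathExp T x f := by
  refine le_antisymm (pathExp_smul_le hT x hf hr) ?_
  have h := pathExp_smul_le hT x (hf.const_mul r) (inv_pos.2 hr)
  simp only [inv_mul_cancel_left₀ hr.ne'] at h
  rwa [inv_mul_eq_div, le_div_iff₀ hr, mul_comm] at h

theorem pathExp_from_above (hT : IsSublinearSemigroup T) (x : M) (h0 : 0 ∈ J)
    {f : ℕ → (ℝ≥0 → M) → ℝ} (hf : ∀ n, BC (f n)) (hJ : ∀ n, DependsOn (f n) (J : Set ℝ≥0))
    (hlim : DecreasesTo f fun _ => 0) : Tendsto (fun n => pathExp T x (f n)) atTop (𝓝 0) := by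
  have h := (pathOp_from_above hT (fun n => ⟨hf n, J, hJ n⟩) (IsCyl.const 0) hlim
    (J.sort (· ≤ ·))).2 fun _ => x
  rw [pathOp_const hT] at h
  refine h.congr fun n => ?_
  rw [pathExp_eq_finExp hT x (hf n) h0 (hJ n)]
  rfl

end PathExp

/-- Positive normalized linear functionals on bounded continuous functions on path space that are
continuous from above along functions of fixed finitely many coordinates. -/
structure IsPathFunctional {M : Type*} [TopologicalSpace M]
    (ℓ : ((ℝ≥0 → M) →ᵇ ℝ) →ₗ[ℝ] ℝ) : Prop where
  nonneg : ∀ f, (∀ ω, 0 ≤ f ω) → 0 ≤ ℓ f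
  one : ℓ (BoundedContinuousFunction.const _ 1) = 1
  from_above : ∀ (J : Finset ℝ≥0) (f : ℕ → (ℝ≥0 → M) →ᵇ ℝ),
    (∀ n, DependsOn (f n) (J : Set ℝ≥0)) → DecreasesTo (fun n => (f n : (ℝ≥0 → M) → ℝ)) 0 →
      Tendsto (fun n => ℓ (f n)) atTop (𝓝 0)

/-- Hahn–Banach extends `c • f₀ ↦ c * N f₀`. For `c < 0` domination on the line follows from `0 = N
0 ≤ N (c • f₀) + N (-c • f₀)`. The remaining properties of `ℓ` are consequences of `ℓ ≤ N`. -/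
theorem exists_isPathFunctional {M : Type*} [TopologicalSpace M] [FirstCountableTopology M]
    {T : ℝ≥0 → (M → ℝ) → M → ℝ} (hT : IsSublinearSemigroup T) (x : M) (f₀ : (ℝ≥0 → M) →ᵇ ℝ) :
    ∃ ℓ : ((ℝ≥0 → M) →ᵇ ℝ) →ₗ[ℝ] ℝ, IsPathFunctional ℓ ∧ (∀ f, ℓ f ≤ pathExp T x f) ∧
      ℓ f₀ = pathExp T x f₀ := by
  classical
  have hbc : ∀ f : (ℝ≥0 → M) →ᵇ ℝ, BC (f : (ℝ≥0 → M) → ℝ) := BC.of_boundedContinuousFunction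
  set N : ((ℝ≥0 → M) →ᵇ ℝ) → ℝ := fun f => pathExp T x f
  have hN_hom : ∀ c : ℝ, 0 < c → ∀ f, N (c • f) = c * N f := fun c hc f =>
    pathExp_smul hT x (hbc f) hc
  have hN_add : ∀ f g, N (f + g) ≤ N f + N g := fun f g => pathExp_add_le hT x (hbc f) (hbc g)
  have hN0 : N 0 = 0 := pathExp_const hT x 0
  have hex : ∃ ℓ : ((ℝ≥0 → M) →ᵇ ℝ) →ₗ[ℝ] ℝ, (∀ f, ℓ f ≤ N f) ∧ ℓ f₀ = N f₀ := by
    obtain ⟨ℓ, hℓ', hℓ⟩ := exists_extension_of_le_sublinear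
      (LinearPMap.mkSpanSingleton' (σ := RingHom.id ℝ) f₀ (N f₀) fun c hc => by
        rcases smul_eq_zero.1 hc with rfl | rfl
        · simp
        · simp [hN0]) N hN_hom hN_add (by
        rintro ⟨f, hf⟩
        obtain ⟨c, rfl⟩ := Submodule.mem_span_singleton.1 hf
        rw [LinearPMap.mkSpanSingleton'_apply]
        simp only [RingHom.id_apply, smul_eq_mul]
        rcases lt_trichotomy c 0 with hc | rfl | hc
        · have h1 := hN_add (c • f₀) ((-c) • f₀)
          rw [← add_smul, add_neg_cancel, zero_smul, hN0, hN_hom (-c) (by linarith)] at h1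
          linarith
        · simp [hN0]
        · rw [hN_hom c hc])
    refine ⟨ℓ, hℓ, (hℓ' ⟨f₀, Submodule.mem_span_singleton_self f₀⟩).trans ?_⟩
    exact LinearPMap.mkSpanSingleton'_apply_self _ _ _ _
  obtain ⟨ℓ, hℓ, hℓ₀⟩ := hex
  have hnonneg : ∀ f : (ℝ≥0 → M) →ᵇ ℝ, (∀ ω, 0 ≤ f ω) → 0 ≤ ℓ f := fun f hf => by
    have h1 := hℓ (-f)
    rw [map_neg] at h1
    have h2 : N (-f) ≤ N 0 := pathExp_mono hT x (hbc _) (hbc _) fun ω => by simpa using hf ω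
    linarith
  refine ⟨ℓ, ⟨hnonneg, ?_, fun J f hJ hlim => ?_⟩, hℓ, hℓ₀⟩
  · have h1 := hℓ (BoundedContinuousFunction.const _ 1)
    have h2 := hℓ (BoundedContinuousFunction.const _ (-1))
    have h3 : BoundedContinuousFunction.const (ℝ≥0 → M) (-1 : ℝ) =
      - BoundedContinuousFunction.const (ℝ≥0 → M) (1 : ℝ) := by ext; simp
    have h4 : N (BoundedContinuousFunction.const _ 1) = 1 := pathExp_const hT x 1
    have h5 : N (BoundedContinuousFunction.const _ (-1)) = -1 := pathExp_const hT x (-1)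
    rw [h5, h3, map_neg] at h2
    linarith
  · have h1 := pathExp_from_above hT x (J := insert 0 J) (by simp) (fun n => hbc (f n))
      (fun n ω ω' h => hJ n fun i hi => h i (by simp [Finset.mem_coe.1 hi])) hlim
    exact squeeze_zero (fun n => hnonneg _ fun ω => hlim.le n ω) (fun n => hℓ (f n)) h1

/-! ### Representation by probability measures -/

/-- Riesz–Markov–Kakutani on a compact space. -/
theorem exists_measure_of_positive {X : Type*} [TopologicalSpace X] [CompactSpace X] [T2Space X]
    [MeasurableSpace X] [BorelSpace X] (ℓ : C(X, ℝ) →ₗ[ℝ] ℝ)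
    (hℓ : ∀ f : C(X, ℝ), (∀ x, 0 ≤ f x) → 0 ≤ ℓ f) :
    ∃ μ : Measure X, IsFiniteMeasure μ ∧ ∀ f : C(X, ℝ), ∫ x, f x ∂μ = ℓ f := by
  have hmono : ∀ f g : C(X, ℝ), (∀ x, f x ≤ g x) → ℓ f ≤ ℓ g := fun f g h => by
    have := hℓ (g - f) fun x => sub_nonneg.2 (h x)
    rw [map_sub] at this
    linarith
  let Λ : CompactlySupportedContinuousMap X ℝ →ₚ[ℝ] ℝ :=
  { toFun g := ℓ g.toContinuousMap
    map_add' g g' := ℓ.map_add g.toContinuousMap g'.toContinuousMap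
    map_smul' c g := ℓ.map_smul c g.toContinuousMap
    monotone' g g' hgg' := hmono _ _ hgg' }
  exact ⟨RealRMK.rieszMeasure Λ, inferInstance, fun f => RealRMK.integral_rieszMeasure Λ
    (CompactlySupportedContinuousMap.continuousMapEquiv f)⟩

/-- A Polish space embeds into a compact metric space, with a measurable left inverse. -/
theorem exists_compact_embedding (M : Type*) [MetricSpace M] [PolishSpace M] [MeasurableSpace M]
    [BorelSpace M] [Nonempty M] :
    ∃ (K : Type) (_ : MetricSpace K) (_ : CompactSpace K) (_ : MeasurableSpace K)
      (_ : BorelSpace K) (ι : M → K) (ρ : K → M), Topology.IsEmbedding ι ∧ Measurable ρ ∧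
        (∀ x, ρ (ι x) = x) ∧ MeasurableSet (Set.range ι) := by
  obtain ⟨F, hF⟩ := Metric.PiNatEmbed.exists_embedding_to_hilbert_cube (X := M)
  let _ : MetricSpace (ℕ → unitInterval) := TopologicalSpace.metrizableSpaceMetric _
  have hme : MeasurableEmbedding F := hF.continuous.measurableEmbedding hF.injective
  exact ⟨ℕ → unitInterval, inferInstance, inferInstance, inferInstance, inferInstance, F,
    hme.invFun, hF, hme.measurable_invFun, hme.leftInverse_invFun, hme.measurableSet_range⟩

/-- The product σ-algebra on an uncountable product can be smaller than the Borel one, so continuity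
alone does not suffice; the function is factored through finitely many coordinates. -/
theorem measurable_of_dependsOn {M : Type*} [TopologicalSpace M] [SecondCountableTopology M]
    [MeasurableSpace M] [BorelSpace M] [Nonempty M] {f : (ℝ≥0 → M) → ℝ} (hf : Continuous f)
    {J : Finset ℝ≥0} (hJ : DependsOn f (J : Set ℝ≥0)) : Measurable f := by
  let m₀ : M := Classical.arbitrary M
  have h : f = fun ω => f (extendPath J m₀ fun i : J => ω i) := by
    funext ω
    exact hJ fun i hi => (extendPath_apply m₀ (fun i : J => ω i) hi).symm
  have hc : Continuous fun y : J → M => f (extendPath J m₀ y) :=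
    hf.comp (continuous_extendPath J m₀)
  have hm : Measurable fun ω : ℝ≥0 → M => fun i : J => ω i :=
    measurable_pi_lambda _ fun i => measurable_pi_apply _
  rw [h]
  exact hc.measurable.comp hm

section Representation

variable {M : Type*} [TopologicalSpace M] {ℓ : ((ℝ≥0 → M) →ᵇ ℝ) →ₗ[ℝ] ℝ} {K : Type*}
  [TopologicalSpace K] [CompactSpace K] {ι : M → K}

/-- The restriction of a continuous function on a compact path space to a smaller path space. -/
def restrictPath (hι : Continuous ι) (g : C(ℝ≥0 → K, ℝ)) : (ℝ≥0 → M) →ᵇ ℝ :=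
  (BoundedContinuousFunction.mkOfCompact g).compContinuous
    ⟨fun ω t => ι (ω t), by fun_prop⟩

/-- The pullback of a functional along `restrictPath`. -/
def pullbackFunctional (hι : Continuous ι) (ℓ : ((ℝ≥0 → M) →ᵇ ℝ) →ₗ[ℝ] ℝ) :
    C(ℝ≥0 → K, ℝ) →ₗ[ℝ] ℝ where
  toFun g := ℓ (restrictPath hι g)
  map_add' g h := ℓ.map_add (restrictPath hι g) (restrictPath hι h)
  map_smul' c g := ℓ.map_smul c (restrictPath hι g)

end Representation

/-- The one-dimensional marginals of the representing measure are concentrated on the range of the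
embedding. -/
theorem ae_mem_range_of_functional {M K : Type*} [TopologicalSpace M] [MetricSpace K]
    [CompactSpace K] [MeasurableSpace K] [BorelSpace K] {ι : M → K} (hι : Continuous ι)
    (hrange : MeasurableSet (Set.range ι)) {ℓ : ((ℝ≥0 → M) →ᵇ ℝ) →ₗ[ℝ] ℝ}
    (hℓ : IsPathFunctional ℓ) [MeasurableSpace (ℝ≥0 → K)] [BorelSpace (ℝ≥0 → K)]
    (μ : Measure (ℝ≥0 → K)) [IsFiniteMeasure μ]
    (hμ : ∀ g : C(ℝ≥0 → K, ℝ), ∫ ξ, g ξ ∂μ = ℓ (restrictPath hι g)) (t : ℝ≥0) :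
    ∀ᵐ ξ ∂μ, ξ t ∈ Set.range ι := by
  have hmt : Measurable fun ξ : ℝ≥0 → K => ξ t := (continuous_apply t).measurable
  suffices h : μ.map (fun ξ => ξ t) (Set.range ι)ᶜ = 0 by
    rw [Measure.map_apply hmt hrange.compl] at h
    exact h
  by_contra hne
  -- If the complement of the range had positive mass, so would a compact subset `F` of it. The
  -- functions `g n` dominate the indicator of `F` but decrease to `0` at every point of the range
  -- of `ι`, which contradicts continuity from above of `ℓ`.
  obtain ⟨F, hFsub, hF, hFpos⟩ := hrange.compl.exists_lt_isCompact_of_ne_top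
    (measure_ne_top (μ.map fun ξ => ξ t) _) (pos_iff_ne_zero.2 hne)
  have hFne : F.Nonempty := by
    rw [Set.nonempty_iff_ne_empty]
    rintro rfl
    simp at hFpos
  let g : ℕ → K → ℝ := fun n z => max 0 (1 - n * Metric.infDist z F)
  have hg : ∀ n, Continuous (g n) := fun n => by
    have := Metric.continuous_infDist_pt F
    fun_prop
  let G : ℕ → C(ℝ≥0 → K, ℝ) := fun n => ⟨fun ξ => g n (ξ t), (hg n).comp (continuous_apply t)⟩
  have hdec : DecreasesTo (fun n => (restrictPath hι (G n) : (ℝ≥0 → M) → ℝ)) 0 := by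
    refine ⟨fun n ω => ?_, fun ω => ?_⟩
    · have h0 : 0 ≤ Metric.infDist (ι (ω t)) F := Metric.infDist_nonneg
      change max 0 (1 - ((n + 1 : ℕ) : ℝ) * Metric.infDist (ι (ω t)) F) ≤
        max 0 (1 - (n : ℝ) * Metric.infDist (ι (ω t)) F)
      refine max_le_max le_rfl ?_
      push_cast
      linarith
    · have hpos : 0 < Metric.infDist (ι (ω t)) F :=
        (hF.isClosed.notMem_iff_infDist_pos hFne).1 fun h => hFsub h ⟨ω t, rfl⟩
      obtain ⟨N, hN⟩ := exists_nat_ge (1 / Metric.infDist (ι (ω t)) F)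
      refine tendsto_const_nhds.congr' ?_
      filter_upwards [eventually_ge_atTop N] with n hn
      change 0 = max 0 (1 - (n : ℝ) * Metric.infDist (ι (ω t)) F)
      rw [max_eq_left]
      rw [div_le_iff₀ hpos] at hN
      have : (N : ℝ) * Metric.infDist (ι (ω t)) F ≤ n * Metric.infDist (ι (ω t)) F := by gcongr
      linarith
  have hlim := hℓ.from_above {t} (fun n => restrictPath hι (G n)) (fun n ω ω' h => by
    change g n (ι (ω t)) = g n (ι (ω' t))
    rw [h t (by simp)]) hdec
  have hle : ∀ n, (μ.map fun ξ => ξ t).real F ≤ ℓ (restrictPath hι (G n)) := fun n => by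
    rw [← hμ]
    change _ ≤ ∫ ξ, g n (ξ t) ∂μ
    rw [← integral_map (φ := fun ξ : ℝ≥0 → K => ξ t) hmt.aemeasurable
      (hg n).measurable.aestronglyMeasurable, ← integral_indicator_one hF.measurableSet]
    refine integral_mono ((integrable_const (1 : ℝ)).indicator hF.measurableSet)
      ((BoundedContinuousFunction.mkOfCompact ⟨g n, hg n⟩).integrable _) fun z => ?_
    by_cases hz : z ∈ F
    · rw [Set.indicator_of_mem hz]
      change (1 : ℝ) ≤ max 0 (1 - n * Metric.infDist z F)
      rw [Metric.infDist_zero_of_mem hz]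
      simp
    · rw [Set.indicator_of_notMem hz]
      exact le_max_left _ _
  have h0 := ge_of_tendsto' hlim hle
  exact absurd h0 (not_le.2 (ENNReal.toReal_pos hFpos.ne' (measure_ne_top _ _)))

/-- Every path functional is represented on cylinder functions by a probability measure on path
space. -/
theorem exists_probabilityMeasure_of_isPathFunctional {M : Type*} [MetricSpace M] [PolishSpace M]
    [MeasurableSpace M] [BorelSpace M] [Nonempty M] {ℓ : ((ℝ≥0 → M) →ᵇ ℝ) →ₗ[ℝ] ℝ}
    (hℓ : IsPathFunctional ℓ) :
    ∃ P : ProbabilityMeasure (ℝ≥0 → M), ∀ (f : (ℝ≥0 → M) →ᵇ ℝ) (J : Finset ℝ≥0),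
      DependsOn f (J : Set ℝ≥0) → ∫ ω, f ω ∂(P : Measure (ℝ≥0 → M)) = ℓ f := by
  obtain ⟨K, _, _, _, _, ι, ρ, hι, hρ, hρι, hrange⟩ := exists_compact_embedding M
  have hιc : Continuous ι := hι.continuous
  let mX : MeasurableSpace (ℝ≥0 → K) := borel _
  have bX : BorelSpace (ℝ≥0 → K) := ⟨rfl⟩
  obtain ⟨μ, hfin, hμ⟩ := exists_measure_of_positive (pullbackFunctional hιc ℓ)
    fun g hg => hℓ.nonneg _ fun ω => hg _
  replace hμ : ∀ g : C(ℝ≥0 → K, ℝ), ∫ ξ, g ξ ∂μ = ℓ (restrictPath hιc g) := hμ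
  have hprob : IsProbabilityMeasure μ := by
    have h1 := hμ (ContinuousMap.const _ 1)
    have h2 : restrictPath hιc (ContinuousMap.const (ℝ≥0 → K) (1 : ℝ)) =
      BoundedContinuousFunction.const (ℝ≥0 → M) (1 : ℝ) := rfl
    rw [h2, hℓ.one] at h1
    simp only [ContinuousMap.const_apply, integral_const, smul_eq_mul, mul_one] at h1
    exact ⟨by rwa [Measure.real, ENNReal.toReal_eq_one_iff] at h1⟩
  let Φ : (ℝ≥0 → K) → ℝ≥0 → M := fun ξ t => ρ (ξ t)
  have hΦ : Measurable Φ := measurable_pi_lambda _ fun t => hρ.comp (continuous_apply t).measurable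
  refine ⟨⟨μ.map Φ, Measure.isProbabilityMeasure_map hΦ.aemeasurable⟩, fun f J hJ => ?_⟩
  -- The exceptional null set depends on `J`. No statement about all times at once is needed, since
  -- only functions of the coordinates in `J` are integrated.
  have hae : ∀ᵐ ξ ∂μ, ∀ i : J, ι (Φ ξ i) = ξ i := by
    rw [ae_all_iff]
    intro i
    filter_upwards [ae_mem_range_of_functional hιc hrange hℓ μ hμ i] with ξ hξ
    obtain ⟨m, hm⟩ := hξ
    simp only [Φ, ← hm, hρι]
  let m₀ : M := Classical.arbitrary M
  let v : (J → M) → ℝ := fun y => f (extendPath J m₀ y)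
  have hvf : ∀ ω, v (fun i => ω i) = f ω := fun ω => hJ fun i hi => extendPath_apply m₀ _ hi
  have hv : Continuous v := f.continuous.comp (continuous_extendPath J m₀)
  have hvC : ∀ y, |v y| ≤ ‖f‖ := fun y => f.norm_coe_le_norm _
  let ιJ : (J → M) → J → K := fun y i => ι (y i)
  have hιJ : Topology.IsInducing ιJ := (Topology.IsEmbedding.piMap fun _ => hι).isInducing
  -- A continuous `v` on `J → M` need not extend continuously to `J → K`. Its sup-convolutions along
  -- `ιJ` are continuous there and decrease to `v` on the image of `ιJ`.
  let G : ℕ → C(ℝ≥0 → K, ℝ) := fun n => ⟨fun ξ => supConv ιJ v n fun i => ξ i,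
    (lipschitzWith_supConv hvC n).continuous.comp (by fun_prop)⟩
  have hG : ∀ n ω, restrictPath hιc (G n) ω = supConv ιJ v n (ιJ fun i => ω i) := fun n ω => rfl
  have h1 : Tendsto (fun n => ℓ (restrictPath hιc (G n))) atTop (𝓝 (ℓ f)) := by
    have hdec : DecreasesTo (fun n => (restrictPath hιc (G n) - f : (ℝ≥0 → M) →ᵇ ℝ) :
        ℕ → (ℝ≥0 → M) → ℝ) 0 := by
      refine ⟨fun n ω => sub_le_sub_right ?_ _, fun ω => ?_⟩
      · exact supConv_mono hvC (fun _ => le_rfl) n.le_succ _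
      · have := (tendsto_supConv hιJ hv hvC fun i => ω i).sub_const (f ω)
        rw [hvf, sub_self] at this
        exact this
    have := hℓ.from_above J _ (fun n ω ω' h => ?_) hdec
    · simp only [map_sub] at this
      simpa using this.add_const (ℓ f)
    · have h' : (fun i : J => ω i) = fun i : J => ω' i := funext fun i => h i i.2
      simp only [BoundedContinuousFunction.coe_sub, Pi.sub_apply, hG, h', hJ h]
  have hfm : Measurable f := measurable_of_dependsOn f.continuous hJ
  have h2 : Tendsto (fun n => ∫ ξ, G n ξ ∂μ) atTop (𝓝 (∫ ξ, f (Φ ξ) ∂μ)) := by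
    refine tendsto_integral_of_dominated_convergence (fun _ => ‖f‖)
      (fun n => (G n).continuous.measurable.aestronglyMeasurable) (integrable_const _)
      (fun n => ?_) ?_
    -- The lower bound `-‖f‖` is taken only on the image of `ιJ`, that is almost everywhere; farther
    -- away the sup-convolution may be smaller.
    · filter_upwards [hae] with ξ hξ
      have hξ' : (fun i : J => ξ i) = ιJ fun i => Φ ξ i := funext fun i => (hξ i).symm
      change |supConv ιJ v n fun i => ξ i| ≤ _
      refine abs_le.2 ⟨?_, supConv_le hvC n _⟩
      rw [hξ']
      exact (abs_le.1 (hvC _)).1.trans (le_supConv hvC n _)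
    · filter_upwards [hae] with ξ hξ
      have hξ' : (fun i : J => ξ i) = ιJ fun i => Φ ξ i := funext fun i => (hξ i).symm
      change Tendsto (fun n => supConv ιJ v n fun i => ξ i) atTop _
      rw [hξ', ← hvf]
      exact tendsto_supConv hιJ hv hvC _
  change ∫ ω, f ω ∂(μ.map Φ) = ℓ f
  rw [integral_map hΦ.aemeasurable hfm.aestronglyMeasurable]
  simp only [hμ] at h2
  exact tendsto_nhds_unique h2 h1

/-! ### The sublinear expectation space -/

/-- The upper expectation of a set of probability measures. -/
def upperExp {Ω : Type*} [MeasurableSpace Ω] (Q : Set (ProbabilityMeasure Ω)) (X : LInfty Ω) : ℝ :=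
  sSup ((fun P : ProbabilityMeasure Ω => ∫ ω, (X : Ω → ℝ) ω ∂(P : Measure Ω)) '' Q)

section UpperExp

variable {Ω : Type*} [MeasurableSpace Ω] {Q : Set (ProbabilityMeasure Ω)}

theorem LInfty.integrable (X : LInfty Ω) (P : ProbabilityMeasure Ω) :
    Integrable (X : Ω → ℝ) (P : Measure Ω) := by
  obtain ⟨hX, C, hC⟩ := X.2
  exact Integrable.of_bound hX.aestronglyMeasurable C (Eventually.of_forall hC)

theorem isLUB_upperExp (hQ : Q.Nonempty) (X : LInfty Ω) :
    IsLUB ((fun P : ProbabilityMeasure Ω => ∫ ω, (X : Ω → ℝ) ω ∂(P : Measure Ω)) '' Q)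
      (upperExp Q X) := by
  refine isLUB_csSup (hQ.image _) ?_
  obtain ⟨-, C, hC⟩ := X.2
  refine ⟨C, ?_⟩
  rintro _ ⟨P, -, rfl⟩
  calc ∫ ω, (X : Ω → ℝ) ω ∂(P : Measure Ω) ≤ ∫ _, C ∂(P : Measure Ω) :=
        integral_mono (LInfty.integrable X P) (integrable_const C) fun ω => (abs_le.1 (hC ω)).2
    _ = C := by simp

theorem isSublinearExpectationSpace_upperExp (hQ : Q.Nonempty) :
    IsSublinearExpectationSpace (upperExp Q) := by
  have hlub := fun X : LInfty Ω => isLUB_upperExp hQ X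
  have hle : ∀ (X : LInfty Ω), ∀ P ∈ Q, ∫ ω, (X : Ω → ℝ) ω ∂(P : Measure Ω) ≤ upperExp Q X :=
    fun X P hP => (hlub X).1 ⟨P, hP, rfl⟩
  have hsup : ∀ (X : LInfty Ω) (r : ℝ), (∀ P ∈ Q, ∫ ω, (X : Ω → ℝ) ω ∂(P : Measure Ω) ≤ r) →
      upperExp Q X ≤ r := fun X r h => (hlub X).2 (by rintro _ ⟨P, hP, rfl⟩; exact h P hP)
  have hsmul : ∀ (r : ℝ), 0 < r → ∀ X : LInfty Ω, upperExp Q (r • X) ≤ r * upperExp Q X := by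
    intro r hr X
    refine hsup _ _ fun P hP => ?_
    change ∫ ω, r * (X : Ω → ℝ) ω ∂(P : Measure Ω) ≤ _
    rw [integral_const_mul]
    exact mul_le_mul_of_nonneg_left (hle X P hP) hr.le
  refine ⟨⟨fun X Y hXY => hsup _ _ fun P hP => ?_, fun a X hX => ?_, fun X Y => hsup _ _ fun P hP => ?_,
    fun r hr X => le_antisymm (hsmul r hr X) ?_⟩, Q, hQ, hlub⟩
  · exact (integral_mono (LInfty.integrable X P) (LInfty.integrable Y P) hXY).trans (hle Y P hP)
  · have h : ∀ P : ProbabilityMeasure Ω, ∫ ω, (X : Ω → ℝ) ω ∂(P : Measure Ω) = a := fun P => by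
      simp [hX]
    obtain ⟨P, hP⟩ := hQ
    exact le_antisymm (hsup _ _ fun P _ => (h P).le) ((h P).ge.trans (hle X P hP))
  · change ∫ ω, ((X : Ω → ℝ) ω + (Y : Ω → ℝ) ω) ∂(P : Measure Ω) ≤ _
    rw [integral_add (LInfty.integrable X P) (LInfty.integrable Y P)]
    exact add_le_add (hle X P hP) (hle Y P hP)
  · have h := hsmul r⁻¹ (inv_pos.2 hr) (r • X)
    rwa [inv_smul_smul₀ hr.ne', inv_mul_eq_div, le_div_iff₀ hr, mul_comm] at h

end UpperExp

/-- The probability measures on path space dominated by the path expectation on cylinder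
functions. -/
def dominatedMeasures {M : Type*} [TopologicalSpace M] [MeasurableSpace M]
    (T : ℝ≥0 → (M → ℝ) → M → ℝ) (x : M) : Set (ProbabilityMeasure (ℝ≥0 → M)) :=
  {P | ∀ (f : (ℝ≥0 → M) →ᵇ ℝ) (J : Finset ℝ≥0), DependsOn f (J : Set ℝ≥0) →
    ∫ ω, f ω ∂(P : Measure (ℝ≥0 → M)) ≤ pathExp T x f}

section DominatedMeasures

variable {M : Type*} [MetricSpace M] [PolishSpace M] [MeasurableSpace M] [BorelSpace M]
  {T : ℝ≥0 → (M → ℝ) → M → ℝ} {f : (ℝ≥0 → M) → ℝ}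

/-- The functional that touches the path expectation at `f` is itself a dominated measure, so the
supremum over `dominatedMeasures` is attained on cylinder functions. -/
theorem exists_mem_dominatedMeasures (hT : IsSublinearSemigroup T) (x : M) (hf : IsCyl f) :
    ∃ P ∈ dominatedMeasures T x, ∫ ω, f ω ∂(P : Measure (ℝ≥0 → M)) = pathExp T x f := by
  have : Nonempty M := ⟨x⟩
  obtain ⟨hf, J, hJ⟩ := hf
  obtain ⟨ℓ, hℓ, hle, heq⟩ := exists_isPathFunctional hT x hf.toBCF
  obtain ⟨P, hP⟩ := exists_probabilityMeasure_of_isPathFunctional hℓ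
  exact ⟨P, fun g K hK => (hP g K hK).le.trans (hle g), (hP hf.toBCF J hJ).trans heq⟩

theorem dominatedMeasures_nonempty (hT : IsSublinearSemigroup T) (x : M) :
    (dominatedMeasures T x).Nonempty :=
  (exists_mem_dominatedMeasures hT x (IsCyl.const 0)).imp fun _ h => h.1

omit [PolishSpace M] in
theorem IsCyl.mem_LInfty [SecondCountableTopology M] [Nonempty M] (hf : IsCyl f) :
    f ∈ LInfty (ℝ≥0 → M) :=
  ⟨measurable_of_dependsOn hf.1.1 hf.2.choose_spec, hf.1.2⟩

theorem upperExp_dominatedMeasures (hT : IsSublinearSemigroup T) (x : M) (hf : IsCyl f)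
    (h : f ∈ LInfty (ℝ≥0 → M)) : upperExp (dominatedMeasures T x) ⟨f, h⟩ = pathExp T x f := by
  refine (isLUB_upperExp (dominatedMeasures_nonempty hT x) ⟨f, h⟩).unique ⟨?_, fun r hr => ?_⟩
  · rintro _ ⟨P, hP, rfl⟩
    obtain ⟨hf, J, hJ⟩ := hf
    exact hP hf.toBCF J hJ
  · obtain ⟨P, hP, hPf⟩ := exists_mem_dominatedMeasures hT x hf
    exact hPf ▸ hr ⟨P, hP, rfl⟩

end DominatedMeasures

/-! ### One-dimensional marginals and the Markov formula -/

section PathFormulas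

variable {M : Type*} [TopologicalSpace M] [FirstCountableTopology M] {T : ℝ≥0 → (M → ℝ) → M → ℝ}

omit [FirstCountableTopology M] in
theorem isCyl_eval {u : M → ℝ} (hu : BC u) (t : ℝ≥0) : IsCyl fun ω : ℝ≥0 → M => u (ω t) :=
  ⟨hu.comp (continuous_apply t), {t}, fun ω ω' h => by simp only [h t (by simp)]⟩

theorem pathExp_eval (hT : IsSublinearSemigroup T) {u : M → ℝ} (hu : BC u) (t : ℝ≥0) (x : M) :
    pathExp T x (fun ω => u (ω t)) = T t u x := by
  have hf := (isCyl_eval hu t).1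
  have hsort : ∀ f : (ℝ≥0 → M) → ℝ, finExp T {0} x f = f fun _ => x := fun f => by
    simp [finExp, pathOp]
  -- `finExp_step` needs a strictly positive time step; at `t = 0` only the initial coordinate is
  -- present.
  rcases eq_or_ne t 0 with rfl | ht
  · rw [pathExp_eq_finExp hT x hf (J := {0}) (by simp) (fun ω ω' h => by simp only [h 0 (by simp)]),
      hsort, hT.zero hu]
  · have hst : (0 : ℝ≥0) < t := pos_iff_ne_zero.2 ht
    have hform : stepOp T 0 t (fun ω => u (ω t)) = fun ω => T t u (ω 0) := by
      funext ω
      simp [stepOp]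
    have hK : DependsOn (fun ω : ℝ≥0 → M => u (ω t)) (({0, t} : Finset ℝ≥0) : Set ℝ≥0) :=
      fun ω ω' h => by simp only [h t (by simp)]
    rw [pathExp_eq_finExp hT x hf (J := {0, t}) (by simp) hK,
      ← finExp_step hT hf hst (J := {0}) (by simp) (by simp) (by simp)
        (fun ω ω' h => by simp only [h t (by simp)]) hK
        (by rw [hform]; exact fun ω ω' h => by simp only [h 0 (by simp)]) x, hform, hsort]

omit [FirstCountableTopology M] in
theorem isCyl_snoc {n : ℕ} (τ : Fin n → ℝ≥0) (t : ℝ≥0) (v : (Fin (n + 1) → M) →ᵇ ℝ) :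
    IsCyl fun ω : ℝ≥0 → M => v (Fin.snoc (fun i => ω (τ i)) (ω t)) := by
  classical
  refine ⟨(BC.of_boundedContinuousFunction v).comp
    (Continuous.finSnoc (by fun_prop) (by fun_prop)), insert t (Finset.univ.image τ),
    fun ω ω' h => ?_⟩
  have h1 : (fun i => ω (τ i)) = fun i => ω' (τ i) := funext fun i => h _ (by simp)
  simp only [h1, h t (by simp)]

omit [FirstCountableTopology M] in
theorem stepOp_snoc {n : ℕ} {τ : Fin n → ℝ≥0} {s t : ℝ≥0} (hst : s < t) (hτ : ∀ i, τ i ≤ s)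
    (v : (Fin (n + 1) → M) →ᵇ ℝ) :
    stepOp T s t (fun ω => v (Fin.snoc (fun i => ω (τ i)) (ω t))) =
      fun ω => T (t - s) (sectionLast v fun i => ω (τ i)) (ω s) := by
  funext ω
  have h : ∀ z i, Function.update ω t z (τ i) = ω (τ i) := fun z i =>
    Function.update_of_ne ((hτ i).trans_lt hst).ne _ _
  simp only [stepOp, h, Function.update_self]
  rfl

/-- Both sides are finite-dimensional expectations, and the right side is the left one with its
innermost step, from `s` to `t`, already carried out. -/
theorem pathExp_snoc (hT : IsSublinearSemigroup T) {n : ℕ} {τ : Fin n → ℝ≥0} {s t : ℝ≥0}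
    (hst : s < t) (hτ : ∀ i, τ i ≤ s) (v : (Fin (n + 1) → M) →ᵇ ℝ) (x : M) :
    pathExp T x (fun ω => v (Fin.snoc (fun i => ω (τ i)) (ω t))) =
      pathExp T x fun ω => T (t - s) (sectionLast v fun i => ω (τ i)) (ω s) := by
  classical
  have hf := isCyl_snoc (M := M) τ t v
  have hg := stepOp_isCyl hT hf s t
  set J : Finset ℝ≥0 := insert 0 (insert s (Finset.univ.image τ)) with hJ
  have hJs : ∀ r ∈ J, r ≤ s := by
    intro r hr
    simp only [hJ, Finset.mem_insert, Finset.mem_image, Finset.mem_univ, true_and] at hr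
    rcases hr with rfl | rfl | ⟨i, rfl⟩
    · exact zero_le
    · exact le_rfl
    · exact hτ i
  have hmem : ∀ i, τ i ∈ (J : Set ℝ≥0) := fun i => by simp [hJ]
  have hfJ : DependsOn (fun ω : ℝ≥0 → M => v (Fin.snoc (fun i => ω (τ i)) (ω t)))
      (insert t (J : Set ℝ≥0)) := fun ω ω' h => by
    have h1 : (fun i => ω (τ i)) = fun i => ω' (τ i) := funext fun i => h _ (Or.inr (hmem i))
    simp only [h1, h t (Or.inl rfl)]
  have hgJ : DependsOn (stepOp T s t fun ω : ℝ≥0 → M => v (Fin.snoc (fun i => ω (τ i)) (ω t)))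
      (J : Set ℝ≥0) := by
    rw [stepOp_snoc hst hτ]
    intro ω ω' h
    have h1 : (fun i => ω (τ i)) = fun i => ω' (τ i) := funext fun i => h _ (hmem i)
    simp only [h1, h s (by simp [hJ])]
  have hK : DependsOn (fun ω : ℝ≥0 → M => v (Fin.snoc (fun i => ω (τ i)) (ω t)))
      ((insert t J : Finset ℝ≥0) : Set ℝ≥0) := by rwa [Finset.coe_insert]
  have h0 : 0 ∈ J := by simp [hJ]
  rw [← stepOp_snoc hst hτ, pathExp_eq_finExp hT x hg.1 h0 hgJ,
    pathExp_eq_finExp hT x hf.1 (Finset.mem_insert_of_mem h0) hK]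
  exact (finExp_step hT hf.1 hst h0 (Finset.mem_insert_of_mem h0) hJs hfJ hK hgJ x).symm

end PathFormulas

end SemigroupEnvelope

end

/-! ### Assembly of the theorem -/

open SemigroupEnvelope Filter in
theorem theorem5p5 {M : Type u} {Λ : Type w} [MetricSpace M] [PolishSpace M]
    [MeasurableSpace M] [BorelSpace M] [Nonempty Λ] (κ : SemigroupEnvelope.Weight M)
    (S : Λ → ℝ≥0 → SemigroupEnvelope.UC κ →ₗ[ℝ] SemigroupEnvelope.UC κ)
    (hS : SemigroupEnvelope.IsLinearFellerFamily κ S)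
    (hbound : SemigroupEnvelope.HasUniformBounds κ S)
    (habove : SemigroupEnvelope.ContinuousFromAboveOn (SemigroupEnvelope.envelope S)
      (SemigroupEnvelope.LipB M)) :
    ∃ T : ℝ≥0 → (M →ᵇ ℝ) → (M →ᵇ ℝ),
      -- `T` is the unique extension of the envelope to `C_b`, denoted by the same symbol
      SemigroupEnvelope.IsExtension S T ∧
      (∀ T' : ℝ≥0 → (M →ᵇ ℝ) → (M →ᵇ ℝ), SemigroupEnvelope.IsExtension S T' → T' = T) ∧
      (∀ (t : ℝ≥0) (u : M →ᵇ ℝ), (u : M → ℝ) ∈ SemigroupEnvelope.UC κ →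
        (T t u : M → ℝ) = SemigroupEnvelope.envelope S t u) ∧
      -- the stochastic representation
      ∃ (Ω : Type u) (_ : MeasurableSpace Ω) (E : M → SemigroupEnvelope.LInfty Ω → ℝ)
        (X : ℝ≥0 → Ω → M),
        (∀ t, Measurable (X t)) ∧
        (∀ x, SemigroupEnvelope.IsSublinearExpectationSpace (E x) ∧
          ∀ u : M →ᵇ ℝ, ∃ h : (fun ω => u (X 0 ω)) ∈ SemigroupEnvelope.LInfty Ω,
            E x ⟨fun ω => u (X 0 ω), h⟩ = u x) ∧
        (∀ (x : M) (s t : ℝ≥0), s < t → ∀ (n : ℕ) (τ : Fin n → ℝ≥0), StrictMono τ →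
          (∀ i, τ i ≤ s) → ∀ v : (Fin (n + 1) → M) →ᵇ ℝ,
          ∃ (h₁ : (fun ω => v (Fin.snoc (fun i => X (τ i) ω) (X t ω))) ∈
                SemigroupEnvelope.LInfty Ω)
            (h₂ : (fun ω => T (t - s) (SemigroupEnvelope.sectionLast v (fun i => X (τ i) ω))
                (X s ω)) ∈ SemigroupEnvelope.LInfty Ω),
            E x ⟨fun ω => v (Fin.snoc (fun i => X (τ i) ω) (X t ω)), h₁⟩ =
              E x ⟨fun ω => T (t - s) (SemigroupEnvelope.sectionLast v (fun i => X (τ i) ω))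
                (X s ω), h₂⟩) ∧
        (∀ (t : ℝ≥0) (x : M) (u : M →ᵇ ℝ),
          ∃ h : (fun ω => u (X t ω)) ∈ SemigroupEnvelope.LInfty Ω,
            T t u x = E x ⟨fun ω => u (X t ω), h⟩) := by
  have hT := isSublinearSemigroup_extOp hS hbound habove
  have hbc := fun u : M →ᵇ ℝ => BC.of_boundedContinuousFunction u
  let T : ℝ≥0 → (M →ᵇ ℝ) → (M →ᵇ ℝ) := fun t u => (hT.bc (hbc u) t).toBCF
  have hext : ∀ (t : ℝ≥0) (u : M →ᵇ ℝ), (u : M → ℝ) ∈ LipB M → (T t u : M → ℝ) = envelope S t u :=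
    fun t u hu => extOp_of_mem_lipB hS hbound hu t
  have heval : ∀ (t : ℝ≥0) (x : M) (u : M →ᵇ ℝ), ∃ h : (fun ω : ℝ≥0 → M => u (ω t)) ∈ LInfty _,
      T t u x = upperExp (dominatedMeasures (extOp S) x) ⟨fun ω => u (ω t), h⟩ := fun t x u => by
    have : Nonempty M := ⟨x⟩
    have hf := isCyl_eval (hbc u) t
    exact ⟨hf.mem_LInfty,
      ((upperExp_dominatedMeasures hT x hf _).trans (pathExp_eval hT (hbc u) t x)).symm⟩
  refine ⟨T, ⟨hext, fun t u w huw => hT.from_above (fun n => hbc (u n)) (hbc w) huw t⟩,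
    fun T' hT' => ?_, fun t u hu => extOp_of_mem_UC hS hbound habove (hbc u) hu t,
    ℝ≥0 → M, inferInstance, fun x => upperExp (dominatedMeasures (extOp S) x), fun t ω => ω t,
    fun t => measurable_pi_apply t, fun x => ⟨?_, fun u => ?_⟩, ?_, heval⟩
  -- Uniqueness: both operators are continuous from above and agree with the envelope along a
  -- sequence in `Lip_b` that decreases to `u`.
  · funext t u
    ext x
    obtain ⟨b, hb, hbu, -⟩ := exists_lipB_decreasesTo (hbc u)
    have h1 := (hT'.continuous_from_above t (fun n => (BC.of_lipB (hb n)).toBCF) u hbu).2 x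
    have h2 := (hT.from_above (fun n => BC.of_lipB (hb n)) (hbc u) hbu t).2 x
    refine tendsto_nhds_unique h1 (h2.congr fun n => ?_)
    exact congrFun ((hext t (BC.of_lipB (hb n)).toBCF (hb n)).trans
      (hT'.extends_envelope t (BC.of_lipB (hb n)).toBCF (hb n)).symm) x
  · exact isSublinearExpectationSpace_upperExp (dominatedMeasures_nonempty hT x)
  · obtain ⟨h, heq⟩ := heval 0 x u
    exact ⟨h, heq.symm.trans (congrFun (hT.zero (hbc u)) x)⟩
  · intro x s t hst n τ _ hτ v
    have : Nonempty M := ⟨x⟩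
    have hf := isCyl_snoc (M := M) τ t v
    have hg := stepOp_isCyl hT hf s t
    -- Being a cylinder function, the conditional expectation is measurable for the product
    -- σ-algebra, which gives its membership in `LInfty`.
    rw [stepOp_snoc hst hτ] at hg
    exact ⟨hf.mem_LInfty, hg.mem_LInfty, (upperExp_dominatedMeasures hT x hf _).trans
      ((pathExp_snoc hT hst hτ v x).trans (upperExp_dominatedMeasures hT x hg _).symm)⟩
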